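/- Fix $n,d,\ell\in\mathbb{N}$. A statistical query on $\{0,1\}^d$ is a function $q:\{0,1\}^d\to[-1,1]$; its value on a probability distribution $\mathcal{D}$ over $\{0,1\}^d$ is $q(\mathcal{D})=\mathbb{E}_{y\sim\mathcal{D}}[q(y)]$. In the $\ell$-round accuracy game between an oracle $\mathcal{O}$ and an adversary $\mathcal{A}$ (both randomized, stateful and computationally unbounded, with independent randomness), $\mathcal{A}$ chooses a distribution $\mathcal{D}$ over $\{0,1\}^d$; samples $x=(x_1,\dots,x_n)$ are drawn i.i.d. from $\mathcal{D}$ and given to $\mathcal{O}$ but not to $\mathcal{A}$; then for $j=1,\dots,\ell$, $\mathcal{A}$ outputs a query $q^j$, which may depend on $q^1,a^1,\dots,q^{j-1},a^{j-1}$, and $\mathcal{O}$ outputs an answer $a^j\in[-1,1]$, which may depend on $x$, the same history and $q^j$. The oracle $\mathcal{O}$ is $(\alpha,\beta,\gamma)$-accurate for $\ell$ adaptively chosen queries given $n$ samples in $\{0,1\}^d$ if for every adversary $\mathcal{A}$, with probability at least $1-\gamma$ in this game, $|a^j-q^j(\mathcal{D})|\le\alpha$ holds for at least $(1-\beta)\ell$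 indices $j\in\{1,\dots,\ell\}$. Theorem. There are an absolute constant $C$ and a function $\ell(n,\beta)\in\mathbb{N}$ such that for every $0\le\beta<1/2$ and every integer $n\ge 1$, $$\ell(n,\beta)\le \frac{C\,n^2}{\left(\frac12-\beta\right)^4},$$ and for every $d\ge\ell(n,\beta)$ there is no oracle (even a computationally unbounded one) that is $(0.99,\beta,1/2)$-accurate for $\ell(n,\beta)$ adaptively chosen queries given $n$ samples in $\{0,1\}^d$. -/

import Mathlib

open MeasureTheory ProbabilityTheory
open scoped ENNReal

namespace AdaptiveSQ

/-- The data universe `{0,1}^d`. -/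
abbrev Cube (d : ℕ) : Type := Fin d → Bool

/-- The interval `[-1,1]`, in which queries and answers take their values. -/
abbrev Value : Type := Set.Icc (-1 : ℝ) 1

/-- A statistical query on `{0,1}^d`, given by a function `q : {0,1}^d → [-1,1]`. -/
abbrev Query (d : ℕ) : Type := Cube d → Value

/-- The value `q(D)`: the expectation of `q y` for `y` drawn from `D`. -/
noncomputable def Query.mean {d : ℕ} (q : Query d) (D : Measure (Cube d)) : ℝ :=
  ∫ y, (q y : ℝ) ∂D

/-- The history of `k` rounds: the queries asked, with the answers received. -/
abbrev History (d k : ℕ) : Type := Fin k → Query d × Value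

universe u

/-- A randomized stateful oracle holding `n` samples in `{0,1}^d`, with no computational
restriction. It draws its random coins once; in each round its answer is an arbitrary (measurable)
function of the coins, the samples, the history of the earlier rounds and the current query. -/
structure Oracle (n d : ℕ) where
  Coins : Type u
  [measurableSpace : MeasurableSpace Coins]
  law : Measure Coins
  [isProbabilityMeasure : IsProbabilityMeasure law]
  answer : (k : ℕ) → Coins → (Fin n → Cube d) → History d k → Query d → Value
  measurable_answer : ∀ k : ℕ, Measurable
    fun p : Coins × (Fin n → Cube d) × History d k × Query d =>
      answer k p.1 p.2.1 p.2.2.1 p.2.2.2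

attribute [instance] Oracle.measurableSpace Oracle.isProbabilityMeasure

/-- A randomized stateful adversary. It draws its random coins, chooses a distribution on
`{0,1}^d` depending on them, and in each round asks a query that is an arbitrary (measurable)
function of the coins and the history. It does not see the samples or the oracle's coins. -/
structure Adversary (d : ℕ) where
  Coins : Type
  [measurableSpace : MeasurableSpace Coins]
  law : Measure Coins
  [isProbabilityMeasure : IsProbabilityMeasure law]
  dist : Kernel Coins (Cube d)
  [isMarkovKernel : IsMarkovKernel dist]
  query : (k : ℕ) → Coins → History d k → Query d
  measurable_query : ∀ k : ℕ, Measurable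
    fun p : Coins × History d k => query k p.1 p.2

attribute [instance] Adversary.measurableSpace Adversary.isProbabilityMeasure
  Adversary.isMarkovKernel

/-- The history of the first `k` rounds of the interaction, for adversary coins `s`, oracle coins
`ω` and samples `x`. -/
def transcript {n d : ℕ} (O : Oracle.{u} n d) (A : Adversary d) (s : A.Coins) (ω : O.Coins)
    (x : Fin n → Cube d) : (k : ℕ) → History d k
  | 0 => Fin.elim0
  | k + 1 =>
    let h := transcript O A s ω x k
    let q := A.query k s h
    Fin.snoc (α := fun _ => Query d × Value) h (q, O.answer k ω x h q)

open Classical in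
/-- In a history, at least `(1-β)ℓ` of the `ℓ` answers are within `α` of the value of the
corresponding query on `D`. -/
def MostlyAccurate {d ℓ : ℕ} (α β : ℝ) (D : Measure (Cube d)) (h : History d ℓ) : Prop :=
  (1 - β) * (ℓ : ℝ) ≤
    ((Finset.univ.filter fun j : Fin ℓ => |((h j).2 : ℝ) - (h j).1.mean D| ≤ α).card : ℝ)

/-- The probability, in the accuracy game of `ℓ` rounds between `O` and `A`, that at least
`(1-β)ℓ` of the answers are within `α` of the truth: the coins of the two parties are independent,
and given the adversary's coins `s` the samples are `n` iid draws from the distribution `A.dist s`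
that it chose. -/
noncomputable def accuracyProb {n d : ℕ} (O : Oracle.{u} n d) (A : Adversary d) (ℓ : ℕ)
    (α β : ℝ) : ℝ≥0∞ :=
  ∫⁻ s, ∫⁻ ω, (Measure.pi fun _ : Fin n => A.dist s)
      {x | MostlyAccurate α β (A.dist s) (transcript O A s ω x ℓ)} ∂O.law ∂A.law

/-- `O` is `(α,β,γ)`-accurate for `ℓ` adaptively chosen queries (given `n` samples in
`{0,1}^d`). -/
def Oracle.IsAccurate {n d : ℕ} (O : Oracle.{u} n d) (α β γ : ℝ) (ℓ : ℕ) : Prop :=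
  ∀ A : Adversary d, ENNReal.ofReal (1 - γ) ≤ accuracyProb O A ℓ α β

end AdaptiveSQ

namespace AdaptiveSQ

section Weighted

variable {Ω : Type*} [Fintype Ω]

/-- The expectation of `F` with respect to the weights `w` on a finite type. -/
def wexp (w F : Ω → ℝ) : ℝ := ∑ x, w x * F x

/-- The total weight of a set. -/
noncomputable def wprob (w : Ω → ℝ) (E : Set Ω) : ℝ := ∑ x, E.indicator w x

lemma wexp_add (w F G : Ω → ℝ) : wexp w (fun x => F x + G x) = wexp w F + wexp w G := by
  simp [wexp, mul_add, Finset.sum_add_distrib]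

lemma wexp_sub (w F G : Ω → ℝ) : wexp w (fun x => F x - G x) = wexp w F - wexp w G := by
  simp [wexp, mul_sub, Finset.sum_sub_distrib]

lemma wexp_const_mul (w F : Ω → ℝ) (a : ℝ) : wexp w (fun x => a * F x) = a * wexp w F := by
  simp only [wexp, Finset.mul_sum]
  exact Finset.sum_congr rfl fun x _ => by ring

lemma wexp_finset_sum {κ : Type*} (s : Finset κ) (w : Ω → ℝ) (F : κ → Ω → ℝ) :
    wexp w (fun x => ∑ k ∈ s, F k x) = ∑ k ∈ s, wexp w (F k) := by
  simp only [wexp, Finset.mul_sum]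
  exact Finset.sum_comm

lemma wexp_const {w : Ω → ℝ} (hw : ∑ x, w x = 1) (a : ℝ) : wexp w (fun _ => a) = a := by
  rw [wexp, ← Finset.sum_mul, hw, one_mul]

lemma wexp_mono {w F G : Ω → ℝ} (hw : ∀ x, 0 ≤ w x) (h : ∀ x, F x ≤ G x) :
    wexp w F ≤ wexp w G :=
  Finset.sum_le_sum fun x _ => mul_le_mul_of_nonneg_left (h x) (hw x)

lemma wexp_le_const {w F : Ω → ℝ} (hw : ∀ x, 0 ≤ w x) (hw1 : ∑ x, w x = 1) {a : ℝ}
    (h : ∀ x, F x ≤ a) : wexp w F ≤ a :=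
  (wexp_mono hw h).trans_eq (wexp_const hw1 a)

/-- Markov's inequality. -/
lemma mul_wprob_le_wexp {w F : Ω → ℝ} (hw : ∀ x, 0 ≤ w x) (hF : ∀ x, 0 ≤ F x) (t : ℝ) :
    t * wprob w {x | t ≤ F x} ≤ wexp w F := by
  rw [wprob, Finset.mul_sum]
  refine Finset.sum_le_sum fun x _ => ?_
  by_cases h : t ≤ F x
  · rw [Set.indicator_of_mem (by exact h), mul_comm]
    exact mul_le_mul_of_nonneg_left h (hw x)
  · rw [Set.indicator_of_notMem (by exact h), mul_zero]
    exact mul_nonneg (hw x) (hF x)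

lemma wprob_mono {w : Ω → ℝ} (hw : ∀ x, 0 ≤ w x) {E E' : Set Ω} (h : E ⊆ E') :
    wprob w E ≤ wprob w E' :=
  Finset.sum_le_sum fun x _ => Set.indicator_le_indicator_of_subset h hw x

lemma wprob_union_le {w : Ω → ℝ} (hw : ∀ x, 0 ≤ w x) (E E' : Set Ω) :
    wprob w (E ∪ E') ≤ wprob w E + wprob w E' := by
  rw [wprob, wprob, wprob, ← Finset.sum_add_distrib]
  refine Finset.sum_le_sum fun x _ => ?_
  by_cases h : x ∈ E <;> by_cases h' : x ∈ E' <;> simp [h, h', hw x]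

end Weighted

section ProductWeight

variable {ι α : Type*} [Fintype ι]

/-- The product weights on `ι → α`. -/
def prodWeight (w : ι → α → ℝ) (x : ι → α) : ℝ := ∏ i, w i (x i)

lemma prodWeight_nonneg {w : ι → α → ℝ} (hw : ∀ i a, 0 ≤ w i a) (x : ι → α) :
    0 ≤ prodWeight w x :=
  Finset.prod_nonneg fun i _ => hw i (x i)

variable [DecidableEq ι]

lemma prodWeight_update_mul (w : ι → α → ℝ) (x : ι → α) (k : ι) (a : α) :
    prodWeight w (Function.update x k a) * w k (x k) = prodWeight w x * w k a := by
  classical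
  simp only [prodWeight]
  rw [← Finset.mul_prod_erase _ _ (Finset.mem_univ k),
    ← Finset.mul_prod_erase _ (fun i => w i (x i)) (Finset.mem_univ k)]
  have : ∏ i ∈ Finset.univ.erase k, w i (Function.update x k a i) =
      ∏ i ∈ Finset.univ.erase k, w i (x i) :=
    Finset.prod_congr rfl fun i hi => by
      rw [Function.update_of_ne (Finset.ne_of_mem_erase hi)]
  rw [this, Function.update_self]
  ring

variable [Fintype α]

lemma sum_prodWeight {w : ι → α → ℝ} (hw : ∀ i, ∑ a, w i a = 1) : ∑ x, prodWeight w x = 1 := by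
  classical
  have h := Finset.prod_univ_sum (fun _ : ι => (Finset.univ : Finset α)) w
  rw [Fintype.piFinset_univ] at h
  simp only [prodWeight]
  rw [← h]
  simp [hw]

/-- Resampling one coordinate does not change the expectation. -/
lemma wexp_resample {w : ι → α → ℝ} (k : ι) (hw : ∑ a, w k a = 1) (F : (ι → α) → ℝ) :
    wexp (prodWeight w) F =
      wexp (prodWeight w) fun x => wexp (w k) fun a => F (Function.update x k a) := by
  classical
  let e : ((ι → α) × α) → ((ι → α) × α) := fun p => (Function.update p.1 k p.2, p.1 k)
  have he : Function.Involutive e := fun p => by simp [e]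
  have h1 : ∑ p : (ι → α) × α, prodWeight w p.1 * w k p.2 * F (Function.update p.1 k p.2) =
      ∑ p : (ι → α) × α, prodWeight w p.1 * w k p.2 * F p.1 := by
    rw [← Equiv.sum_comp he.toPerm]
    refine Finset.sum_congr rfl fun p _ => ?_
    simp only [Function.Involutive.coe_toPerm, e, Function.update_idem, Function.update_eq_self]
    rw [prodWeight_update_mul]
  rw [Fintype.sum_prod_type, Fintype.sum_prod_type] at h1
  simp only [wexp, Finset.mul_sum]
  calc ∑ x, prodWeight w x * F x
      = ∑ x, ∑ a, prodWeight w x * w k a * F x := by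
        refine Finset.sum_congr rfl fun x _ => ?_
        rw [← Finset.sum_mul, ← Finset.mul_sum, hw, mul_one]
    _ = _ := by
        rw [← h1]
        exact Finset.sum_congr rfl fun x _ => Finset.sum_congr rfl fun a _ => by ring

/-- A sum of martingale differences has second moment at most the sum of the conditional second
moments. -/
lemma wexp_sq_sum_le [LinearOrder ι] {w : ι → α → ℝ} (hw0 : ∀ i a, 0 ≤ w i a)
    (hw1 : ∀ i, ∑ a, w i a = 1) (X : ι → (ι → α) → ℝ) (V : ι → ℝ)
    (hadapted : ∀ j k, j < k → ∀ x a, X j (Function.update x k a) = X j x)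
    (hmean : ∀ k x, wexp (w k) (fun a => X k (Function.update x k a)) = 0)
    (hvar : ∀ k x, wexp (w k) (fun a => X k (Function.update x k a) ^ 2) ≤ V k) :
    wexp (prodWeight w) (fun x => (∑ k, X k x) ^ 2) ≤ ∑ k, V k := by
  have hlt : ∀ j k, j < k → wexp (prodWeight w) (fun x => X j x * X k x) = 0 := by
    intro j k hjk
    rw [wexp_resample k (hw1 k)]
    simp only [hadapted j k hjk, wexp_const_mul, hmean, mul_zero]
    simp [wexp]
  have hne : ∀ j k, j ≠ k → wexp (prodWeight w) (fun x => X j x * X k x) = 0 := by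
    intro j k hjk
    rcases lt_or_gt_of_ne hjk with h | h
    · exact hlt j k h
    · simpa only [mul_comm] using hlt k j h
  have hexp : ∀ x, (∑ k, X k x) ^ 2 = ∑ j, ∑ k, X j x * X k x := fun x => by
    rw [sq, Finset.sum_mul_sum]
  simp only [hexp, wexp_finset_sum]
  refine Finset.sum_le_sum fun j _ => ?_
  rw [Finset.sum_eq_single j (fun k _ hk => hne j k hk.symm) (by simp), wexp_resample j (hw1 j)]
  simp only [← sq]
  exact wexp_le_const (prodWeight_nonneg hw0) (sum_prodWeight hw1) (hvar j)

end ProductWeight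

section RiemannSum

lemma eventually_riemannSum_deriv_sub_le {h h' : ℝ → ℝ} (hd : ∀ x, HasDerivAt h (h' x) x)
    (hc : Continuous h') {a b : ℝ} (hab : a < b) {ε : ℝ} (hε : 0 < ε) :
    ∀ᶠ m : ℕ in Filter.atTop,
      |(b - a) / m * ∑ k : Fin m, h' (a + k * ((b - a) / m)) - (h b - h a)| ≤ ε := by
  have huc := isCompact_Icc.uniformContinuousOn_of_continuous (hc.continuousOn (s := Set.Icc a b))
  rw [Metric.uniformContinuousOn_iff] at huc
  have hba : 0 < b - a := sub_pos.2 hab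
  obtain ⟨δ, hδ, hδ'⟩ := huc (ε / (b - a)) (div_pos hε hba)
  have hlim : Filter.Tendsto (fun m : ℕ => (b - a) / (m : ℝ)) Filter.atTop (nhds 0) :=
    tendsto_const_div_atTop_nhds_zero_nat _
  filter_upwards [hlim.eventually (gt_mem_nhds hδ), Filter.eventually_ge_atTop 1] with m hm hm1
  have hm0 : (0 : ℝ) < m := by exact_mod_cast hm1
  set s := (b - a) / (m : ℝ) with hs
  have hs0 : 0 < s := div_pos hba hm0
  have hsm : m * s = b - a := by rw [hs]; field_simp
  have hstep : ∀ k ∈ Finset.range m,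
      |s * h' (a + k * s) - (h (a + (k + 1 : ℕ) * s) - h (a + k * s))| ≤ s * (ε / (b - a)) := by
    intro k hk
    have hk' : ((k : ℝ) + 1) ≤ m := by exact_mod_cast Finset.mem_range.1 hk
    have hk0 : (0 : ℝ) ≤ k := Nat.cast_nonneg k
    have hub : a + ((k : ℝ) + 1) * s ≤ b := by nlinarith
    have hlb : a ≤ a + k * s := by nlinarith
    have hlt : a + k * s < a + ((k : ℝ) + 1) * s := by nlinarith
    obtain ⟨y, hy, hy'⟩ := exists_hasDerivAt_eq_slope h h' hlt
      (fun x _ => (hd x).continuousAt.continuousWithinAt) (fun x _ => hd x)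
    have hdiff : h (a + ((k : ℝ) + 1) * s) - h (a + k * s) = s * h' y := by
      rw [hy']
      have : a + ((k : ℝ) + 1) * s - (a + k * s) = s := by ring
      rw [this]
      field_simp
    push_cast
    rw [hdiff, ← mul_sub, abs_mul, abs_of_pos hs0]
    refine mul_le_mul_of_nonneg_left ?_ hs0.le
    have := hδ' (a + k * s) ⟨hlb, hlt.le.trans hub⟩ y ⟨hlb.trans hy.1.le, hy.2.le.trans hub⟩ (by
      rw [Real.dist_eq, abs_sub_comm, abs_of_pos (sub_pos.2 hy.1)]
      linarith [hy.2])
    rw [Real.dist_eq] at this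
    exact this.le
  have htel := Finset.sum_range_sub (fun k : ℕ => h (a + k * s)) m
  have hend : a + (m : ℝ) * s = b := by rw [hsm]; ring
  simp only [hend, Nat.cast_zero, zero_mul, add_zero] at htel
  rw [Fin.sum_univ_eq_sum_range (fun k : ℕ => h' (a + k * s)), ← htel, Finset.mul_sum,
    ← Finset.sum_sub_distrib]
  refine (Finset.abs_sum_le_sum_abs _ _).trans ((Finset.sum_le_sum hstep).trans_eq ?_)
  rw [Finset.sum_const, Finset.card_range, nsmul_eq_mul, ← mul_assoc, hsm]
  field_simp

end RiemannSum

section Column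

/-- A bit read as a sign. -/
def sgn (b : Bool) : ℝ := if b then 1 else -1

@[simp] lemma sgn_true : sgn true = 1 := rfl

@[simp] lemma sgn_false : sgn false = -1 := rfl

@[simp] lemma sgn_sq (b : Bool) : sgn b ^ 2 = 1 := by cases b <;> simp

lemma abs_sgn (b : Bool) : |sgn b| = 1 := by cases b <;> simp

/-- The distribution of a random sign of mean `sin t`. -/
noncomputable def bitWeight (t : ℝ) (b : Bool) : ℝ := (1 + sgn b * Real.sin t) / 2

/-- The standardization of a random sign of mean `sin t`. -/
noncomputable def bitScore (t : ℝ) (b : Bool) : ℝ := (sgn b - Real.sin t) / Real.cos t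

lemma bitWeight_nonneg (t : ℝ) (b : Bool) : 0 ≤ bitWeight t b := by
  have h1 := Real.sin_le_one t
  have h2 := Real.neg_one_le_sin t
  cases b <;> simp only [bitWeight, sgn_true, sgn_false] <;> linarith

lemma sum_bitWeight (t : ℝ) : ∑ b, bitWeight t b = 1 := by
  simp only [bitWeight, Fintype.sum_bool, sgn_true, sgn_false]
  ring

/-- The standardized sign is the logarithmic derivative in `t` of the weight. -/
lemma bitWeight_mul_bitScore (t : ℝ) (b : Bool) :
    bitWeight t b * bitScore t b = sgn b * Real.cos t / 2 := by
  by_cases h : Real.cos t = 0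
  · simp [bitScore, h]
  · have := Real.sin_sq_add_cos_sq t
    simp only [bitWeight, bitScore]
    field_simp
    cases b <;> simp only [sgn_true, sgn_false]
    · linear_combination this
    · linear_combination -this

lemma wexp_bitScore (t : ℝ) : wexp (bitWeight t) (bitScore t) = 0 := by
  simp only [wexp, bitWeight_mul_bitScore, Fintype.sum_bool, sgn_true, sgn_false]
  ring

lemma wexp_bitScore_sq_le (t : ℝ) : wexp (bitWeight t) (fun b => bitScore t b ^ 2) ≤ 1 := by
  have h : ∀ b, bitWeight t b * bitScore t b ^ 2 =
      sgn b * (sgn b - Real.sin t) / 2 * (Real.cos t / Real.cos t) := fun b => by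
    rw [sq, ← mul_assoc, bitWeight_mul_bitScore, bitScore]
    ring
  simp only [wexp, h, Fintype.sum_bool, sgn_true, sgn_false]
  calc _ = Real.cos t / Real.cos t := by ring
    _ ≤ 1 := div_self_le_one _

lemma bitWeight_sgn_mul_pi_div_two (b b' : Bool) :
    bitWeight (sgn b * (Real.pi / 2)) b' = if b' = b then 1 else 0 := by
  cases b <;> cases b' <;> simp [bitWeight]

lemma bitScore_sgn_mul_pi_div_two (b b' : Bool) : bitScore (sgn b * (Real.pi / 2)) b' = 0 := by
  have : Real.cos (sgn b * (Real.pi / 2)) = 0 := by cases b <;> simp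
  simp [bitScore, this]

variable {ι : Type*} [Fintype ι]

/-- The distribution of a column of independent signs of mean `sin t`. -/
noncomputable def colWeight (ι : Type*) [Fintype ι] (t : ℝ) : (ι → Bool) → ℝ :=
  prodWeight fun _ => bitWeight t

lemma colWeight_nonneg (t : ℝ) (c : ι → Bool) : 0 ≤ colWeight ι t c :=
  prodWeight_nonneg (fun _ => bitWeight_nonneg t) c

lemma colWeight_sgn_mul_pi_div_two [DecidableEq (ι → Bool)] (b : Bool) (c : ι → Bool) :
    colWeight ι (sgn b * (Real.pi / 2)) c = if c = fun _ => b then 1 else 0 := by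
  simp only [colWeight, prodWeight, bitWeight_sgn_mul_pi_div_two]
  split_ifs with h
  · subst h
    simp
  · obtain ⟨i, hi⟩ := Function.ne_iff.1 h
    exact Finset.prod_eq_zero (Finset.mem_univ i) (if_neg hi)

variable [DecidableEq ι]

lemma sum_colWeight (t : ℝ) : ∑ c, colWeight ι t c = 1 := sum_prodWeight fun _ => sum_bitWeight t

lemma wexp_colWeight_sgn_mul_pi_div_two (b : Bool) (F : (ι → Bool) → ℝ) :
    wexp (colWeight ι (sgn b * (Real.pi / 2))) F = F fun _ => b := by
  classical
  simp [wexp, colWeight_sgn_mul_pi_div_two]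

lemma wexp_mul_bitScore_eq_zero (t : ℝ) (i : ι) {F : (ι → Bool) → ℝ}
    (hF : ∀ c b, F (Function.update c i b) = F c) :
    wexp (colWeight ι t) (fun c => F c * bitScore t (c i)) = 0 := by
  rw [colWeight, wexp_resample i (sum_bitWeight t)]
  simp only [hF, Function.update_self, wexp_const_mul, wexp_bitScore, mul_zero]
  simp [wexp]

lemma wexp_coord (t : ℝ) (i : ι) (F : Bool → ℝ) :
    wexp (colWeight ι t) (fun c => F (c i)) = wexp (bitWeight t) F := by
  rw [colWeight, wexp_resample i (sum_bitWeight t)]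
  simp only [Function.update_self]
  exact wexp_const (sum_prodWeight fun _ => sum_bitWeight t) _

lemma wexp_sq_sum_bitScore_le [LinearOrder ι] (t : ℝ) (S : Finset ι) :
    wexp (colWeight ι t) (fun c => (∑ i ∈ S, bitScore t (c i)) ^ 2) ≤ S.card := by
  have h := wexp_sq_sum_le (w := fun _ : ι => bitWeight t) (fun _ => bitWeight_nonneg t)
    (fun _ => sum_bitWeight t) (fun i c => if i ∈ S then bitScore t (c i) else 0)
    (fun i => if i ∈ S then 1 else 0)
    (fun j k hjk x a => by simp [hjk.ne])
    (fun k x => by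
      by_cases hk : k ∈ S
      · simpa [hk] using wexp_bitScore t
      · simp [hk, wexp])
    (fun k x => by
      by_cases hk : k ∈ S
      · simpa [hk] using wexp_bitScore_sq_le t
      · simp [hk, wexp])
  simpa [colWeight] using h

lemma hasDerivAt_colWeight (c : ι → Bool) (t : ℝ) :
    HasDerivAt (fun t => colWeight ι t c) (colWeight ι t c * ∑ i, bitScore t (c i)) t := by
  have h1 : ∀ i ∈ (Finset.univ : Finset ι),
      HasDerivAt (fun t => bitWeight t (c i)) (bitWeight t (c i) * bitScore t (c i)) t := by
    intro i _
    rw [bitWeight_mul_bitScore]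
    exact (((Real.hasDerivAt_sin t).const_mul (sgn (c i))).const_add 1).div_const 2
  have h2 := HasDerivAt.fun_finsetProd h1
  simp only [colWeight, prodWeight]
  refine h2.congr_deriv ?_
  rw [Finset.mul_sum]
  refine Finset.sum_congr rfl fun i hi => ?_
  rw [← Finset.mul_prod_erase _ (fun i => bitWeight t (c i)) hi, smul_eq_mul]
  ring

lemma continuous_colWeight_mul_sum_bitScore (c : ι → Bool) :
    Continuous fun t => colWeight ι t c * ∑ i, bitScore t (c i) := by
  have h : ContDiff ℝ 1 fun t => colWeight ι t c := by
    simp only [colWeight, prodWeight, bitWeight]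
    exact contDiff_prod fun i _ =>
      ((contDiff_const.add (contDiff_const.mul Real.contDiff_sin)).div_const 2)
  have h' := h.continuous_deriv le_rfl
  have : deriv (fun t => colWeight ι t c) = fun t => colWeight ι t c * ∑ i, bitScore t (c i) :=
    funext fun t => (hasDerivAt_colWeight c t).deriv
  rwa [this] at h'

/-- The points of the uniform grid of mesh `π / m` in `[-π/2, π/2)`. -/
noncomputable def gridAngle {m : ℕ} (k : Fin m) : ℝ := -(Real.pi / 2) + k * (Real.pi / m)

/-- On a fine grid of angles, the average correlation of a bounded function of a random column
with the sum of its standardized entries is almost the difference of the values of the function at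
the two constant columns, divided by `π`. -/
lemma exists_grid (ι : Type*) [Fintype ι] [DecidableEq ι] {ε : ℝ} (hε : 0 < ε) :
    ∃ m : ℕ, 1 ≤ m ∧ ∀ F : (ι → Bool) → ℝ, (∀ c, |F c| ≤ 1) →
      |(∑ k : Fin m, wexp (colWeight ι (gridAngle k))
          (fun c => F c * ∑ i, bitScore (gridAngle k) (c i))) / m -
        (F (fun _ => true) - F (fun _ => false)) / Real.pi| ≤ ε := by
  have hπ := Real.pi_pos
  set M : ℝ := (Fintype.card (ι → Bool) : ℝ) with hM
  have hM0 : 0 < M := by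
    rw [hM]
    exact_mod_cast Fintype.card_pos
  have hev : ∀ᶠ m : ℕ in Filter.atTop, ∀ c : ι → Bool, _ :=
    Filter.eventually_all.2 fun c => eventually_riemannSum_deriv_sub_le
      (hasDerivAt_colWeight c) (continuous_colWeight_mul_sum_bitScore c)
      (show -(Real.pi / 2) < Real.pi / 2 by linarith)
      (show 0 < Real.pi * ε / M by positivity)
  obtain ⟨m, hm, hm1⟩ := (hev.and (Filter.eventually_ge_atTop 1)).exists
  refine ⟨m, hm1, fun F hF => ?_⟩
  have hm0 : (0 : ℝ) < m := by exact_mod_cast hm1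
  have hlen : Real.pi / 2 - -(Real.pi / 2) = Real.pi := by ring
  simp only [hlen] at hm
  have hend : ∀ b, ∑ c, F c * colWeight ι (sgn b * (Real.pi / 2)) c = F fun _ => b := fun b => by
    rw [← wexp_colWeight_sgn_mul_pi_div_two b F, wexp]
    exact Finset.sum_congr rfl fun c _ => mul_comm _ _
  have ht := hend true
  have hf := hend false
  simp only [sgn_true, sgn_false, one_mul, neg_mul] at ht hf
  have key : (∑ k : Fin m, wexp (colWeight ι (gridAngle k))
          (fun c => F c * ∑ i, bitScore (gridAngle k) (c i))) / m -
        (F (fun _ => true) - F (fun _ => false)) / Real.pi =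
      (∑ c, F c * (Real.pi / m * ∑ k : Fin m, (colWeight ι (gridAngle k) c *
        ∑ i, bitScore (gridAngle k) (c i)) - (colWeight ι (Real.pi / 2) c -
          colWeight ι (-(Real.pi / 2)) c))) / Real.pi := by
    simp only [mul_sub, Finset.sum_sub_distrib, ht, hf]
    rw [eq_comm, sub_div]
    congr 1
    simp only [wexp]
    rw [eq_comm]
    rw [Finset.sum_comm]
    rw [Finset.sum_div, Finset.sum_div]
    refine Finset.sum_congr rfl fun c _ => ?_
    rw [Finset.sum_div, mul_div_assoc, mul_div_right_comm, Finset.mul_sum, Finset.mul_sum]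
    refine Finset.sum_congr rfl fun k _ => ?_
    field_simp
  rw [key, abs_div, abs_of_pos hπ, div_le_iff₀ hπ]
  refine (Finset.abs_sum_le_sum_abs _ _).trans ?_
  calc _ ≤ ∑ _c : ι → Bool, Real.pi * ε / M := by
        refine Finset.sum_le_sum fun c _ => ?_
        rw [abs_mul]
        exact (mul_le_of_le_one_left (abs_nonneg _) (hF c)).trans (hm c)
    _ = ε * Real.pi := by
        rw [Finset.sum_const, Finset.card_univ, nsmul_eq_mul, ← hM]
        field_simp

end Column

section Round

variable {m : ℕ}

/-- The angle of a round: an endpoint of `[-π/2, π/2]`, or a point of the grid. -/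
noncomputable def angle : Bool ⊕ Fin m → ℝ
  | .inl b => sgn b * (Real.pi / 2)
  | .inr k => gridAngle k

/-- The distribution of the angle: with probability `1 - η` an endpoint, otherwise a point of the
grid. -/
noncomputable def modeWeight (η : ℝ) : Bool ⊕ Fin m → ℝ
  | .inl _ => (1 - η) / 2
  | .inr _ => η / m

variable {ι : Type*} [Fintype ι]

/-- The distribution of the angle and the column of a round. -/
noncomputable def roundWeight (η : ℝ) (p : (Bool ⊕ Fin m) × (ι → Bool)) : ℝ :=
  modeWeight η p.1 * colWeight ι (angle p.1) p.2

lemma modeWeight_nonneg {η : ℝ} (h0 : 0 ≤ η) (h1 : η ≤ 1) (k : Bool ⊕ Fin m) :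
    0 ≤ modeWeight η k := by
  cases k
  · simp only [modeWeight]
    linarith
  · simp only [modeWeight]
    positivity

lemma sum_modeWeight (η : ℝ) (hm : 1 ≤ m) : ∑ k : Bool ⊕ Fin m, modeWeight η k = 1 := by
  have hm0 : (m : ℝ) ≠ 0 := by positivity
  simp only [modeWeight, Fintype.sum_sum_type, Finset.sum_const, Finset.card_univ,
    Fintype.card_bool, Fintype.card_fin, nsmul_eq_mul]
  field_simp
  push_cast
  ring

lemma roundWeight_nonneg {η : ℝ} (h0 : 0 ≤ η) (h1 : η ≤ 1)
    (p : (Bool ⊕ Fin m) × (ι → Bool)) : 0 ≤ roundWeight η p :=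
  mul_nonneg (modeWeight_nonneg h0 h1 _) (colWeight_nonneg _ _)

/-- The indicator of a round in which the column is constant but the sign `f` of the answer is not
that constant. -/
noncomputable def wrongSign (p : (Bool ⊕ Fin m) × (ι → Bool)) (f : Bool) : ℝ :=
  open Classical in if ∃ b, p.1 = .inl b ∧ (p.2 = fun _ => b) ∧ f ≠ b then 1 else 0

lemma wrongSign_nonneg (p : (Bool ⊕ Fin m) × (ι → Bool)) (f : Bool) : 0 ≤ wrongSign p f := by
  unfold wrongSign
  split_ifs <;> simp

lemma wrongSign_le_one (p : (Bool ⊕ Fin m) × (ι → Bool)) (f : Bool) : wrongSign p f ≤ 1 := by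
  unfold wrongSign
  split_ifs <;> simp

variable [DecidableEq ι]

lemma wexp_roundWeight (η : ℝ) (F : (Bool ⊕ Fin m) × (ι → Bool) → ℝ) :
    wexp (roundWeight η) F =
      wexp (modeWeight η) fun k => wexp (colWeight ι (angle k)) fun c => F (k, c) := by
  simp only [wexp, roundWeight, Fintype.sum_prod_type, Finset.mul_sum, mul_assoc]

lemma sum_roundWeight (η : ℝ) (hm : 1 ≤ m) :
    ∑ p : (Bool ⊕ Fin m) × (ι → Bool), roundWeight η p = 1 := by
  simp only [roundWeight, Fintype.sum_prod_type, ← Finset.mul_sum, sum_colWeight, mul_one,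
    sum_modeWeight η hm]

lemma wexp_round_le {η : ℝ} (h0 : 0 ≤ η) (h1 : η ≤ 1) (hm : 1 ≤ m)
    {F : (Bool ⊕ Fin m) × (ι → Bool) → ℝ} {a : ℝ}
    (h : ∀ k, wexp (colWeight ι (angle k)) (fun c => F (k, c)) ≤ a) :
    wexp (roundWeight η) F ≤ a := by
  rw [wexp_roundWeight]
  exact wexp_le_const (modeWeight_nonneg h0 h1) (sum_modeWeight η hm) h

/-- The correlation of the answer with the column, plus a multiple of the probability of a wrong
sign, is bounded below. -/
lemma le_wexp_correlation_add_wrongSign {η ε lam : ℝ} (hη : 0 ≤ η)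
    (hlam : lam * (1 - η) / 2 = 2 * η / Real.pi) (hm : 1 ≤ m)
    (hgrid : ∀ F : (ι → Bool) → ℝ, (∀ c, |F c| ≤ 1) →
      |(∑ k : Fin m, wexp (colWeight ι (gridAngle k))
          (fun c => F c * ∑ i, bitScore (gridAngle k) (c i))) / m -
        (F (fun _ => true) - F (fun _ => false)) / Real.pi| ≤ ε)
    (f : (ι → Bool) → Bool) (S : Finset ι)
    (hf : ∀ i, i ∉ S → ∀ c b, f (Function.update c i b) = f c) :
    2 * η / Real.pi - η * ε ≤ wexp (roundWeight (m := m) η) fun p =>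
      sgn (f p.2) * (∑ i ∈ S, bitScore (angle p.1) (p.2 i)) + lam * wrongSign p (f p.2) := by
  have hm0 : (0 : ℝ) < m := by exact_mod_cast hm
  have hinl : ∀ b : Bool, wexp (colWeight ι (angle (m := m) (.inl b))) (fun c =>
      sgn (f c) * (∑ i ∈ S, bitScore (angle (m := m) (.inl b)) (c i)) +
        lam * wrongSign (m := m) (.inl b, c) (f c)) =
      lam * if f (fun _ => b) ≠ b then 1 else 0 := by
    intro b
    simp only [angle, bitScore_sgn_mul_pi_div_two, Finset.sum_const_zero, mul_zero, zero_add,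
      wexp_colWeight_sgn_mul_pi_div_two]
    simp [wrongSign]
  have hinr : ∀ k : Fin m, wexp (colWeight ι (angle (.inr k))) (fun c =>
      sgn (f c) * (∑ i ∈ S, bitScore (angle (.inr k)) (c i)) +
        lam * wrongSign (.inr k, c) (f c)) =
      wexp (colWeight ι (gridAngle k)) (fun c => sgn (f c) * ∑ i, bitScore (gridAngle k) (c i)) := by
    intro k
    have hw : ∀ c, wrongSign (ι := ι) (.inr k, c) (f c) = 0 := fun c => by simp [wrongSign]
    simp only [hw, mul_zero, add_zero, angle, Finset.mul_sum, wexp_finset_sum]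
    refine Finset.sum_subset (Finset.subset_univ S) fun i _ hi => ?_
    exact wexp_mul_bitScore_eq_zero _ i fun c b => by rw [hf i hi]
  rw [wexp_roundWeight]
  unfold wexp
  rw [Fintype.sum_sum_type]
  have h := (abs_le.1 (hgrid (fun c => sgn (f c)) fun c => (abs_sgn _).le)).1
  have hsum : ∑ k : Fin m, modeWeight η (.inr k) * wexp (colWeight ι (angle (.inr k))) (fun c =>
      sgn (f c) * (∑ i ∈ S, bitScore (angle (.inr k)) (c i)) +
        lam * wrongSign (.inr k, c) (f c)) =
      η * ((∑ k : Fin m, wexp (colWeight ι (gridAngle k))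
          (fun c => sgn (f c) * ∑ i, bitScore (gridAngle k) (c i))) / m) := by
    simp only [hinr, modeWeight, ← Finset.mul_sum]
    ring
  have hsum' : ∑ b : Bool, modeWeight (m := m) η (.inl b) *
      wexp (colWeight ι (angle (m := m) (.inl b))) (fun c =>
      sgn (f c) * (∑ i ∈ S, bitScore (angle (m := m) (.inl b)) (c i)) +
        lam * wrongSign (m := m) (.inl b, c) (f c)) =
      η * ((2 - (sgn (f fun _ => true) - sgn (f fun _ => false))) / Real.pi) := by
    have h2 : η * ((2 - (sgn (f fun _ => true) - sgn (f fun _ => false))) / Real.pi) =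
        (2 * η / Real.pi) * ((2 - (sgn (f fun _ => true) - sgn (f fun _ => false))) / 2) := by
      ring
    simp only [hinl, modeWeight, Fintype.sum_bool]
    rw [h2, ← hlam]
    cases f (fun _ => true) <;> cases f (fun _ => false) <;>
      simp only [sgn_true, sgn_false, ne_eq, reduceCtorEq, not_false_eq_true, not_true_eq_false,
        if_true, if_false] <;> ring
  have hsum₂ := congrArg₂ (· + ·) hsum' hsum
  simp only [wexp] at hsum₂ h
  refine le_of_le_of_eq ?_ hsum₂.symm
  have h3 := mul_le_mul_of_nonneg_left h hη
  have h4 : η * ((2 - (sgn (f fun _ => true) - sgn (f fun _ => false))) / Real.pi) =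
      2 * η / Real.pi - η * ((sgn (f fun _ => true) - sgn (f fun _ => false)) / Real.pi) := by
    ring
  rw [h4]
  linarith

/-- The standardized entry of a user on which the answer does not depend is uncorrelated with the
answer. -/
lemma wexp_round_mul_bitScore_eq_zero (η : ℝ) (i : ι) {F : (ι → Bool) → ℝ}
    (hF : ∀ c b, F (Function.update c i b) = F c) :
    wexp (roundWeight (m := m) η) (fun p => F p.2 * bitScore (angle p.1) (p.2 i)) = 0 := by
  rw [wexp_roundWeight]
  simp only [wexp_mul_bitScore_eq_zero _ i hF]
  simp [wexp]

lemma wexp_round_bitScore_sq_le {η : ℝ} (h0 : 0 ≤ η) (h1 : η ≤ 1) (hm : 1 ≤ m) (i : ι) :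
    wexp (roundWeight (m := m) η) (fun p => bitScore (angle p.1) (p.2 i) ^ 2) ≤ 1 :=
  wexp_round_le h0 h1 hm fun k => by
    rw [wexp_coord (angle k) i fun b => bitScore (angle k) b ^ 2]
    exact wexp_bitScore_sq_le _

lemma wexp_round_sq_sum_bitScore_le [LinearOrder ι] {η : ℝ} (h0 : 0 ≤ η) (h1 : η ≤ 1)
    (hm : 1 ≤ m) (S : Finset ι) :
    wexp (roundWeight (m := m) η) (fun p => (∑ i ∈ S, bitScore (angle p.1) (p.2 i)) ^ 2) ≤
      S.card :=
  wexp_round_le h0 h1 hm fun _ => wexp_sq_sum_bitScore_le _ S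

end Round

section Stopped

/-- The partial sums of `x`, frozen once they exceed `σ`. -/
noncomputable def stopped (σ : ℝ) (x : ℕ → ℝ) : ℕ → ℝ
  | 0 => 0
  | k + 1 => if σ < stopped σ x k then stopped σ x k else stopped σ x k + x k

lemma stopped_congr {σ : ℝ} {x y : ℕ → ℝ} {k : ℕ} (h : ∀ j < k, x j = y j) :
    stopped σ x k = stopped σ y k := by
  induction k with
  | zero => rfl
  | succ k ih => rw [stopped, stopped, ih fun j hj => h j (by omega), h k (by omega)]

lemma stopped_eq_sum (σ : ℝ) (x : ℕ → ℝ) (k : ℕ) :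
    stopped σ x k = ∑ j ∈ Finset.range k, if σ < stopped σ x j then 0 else x j := by
  induction k with
  | zero => rfl
  | succ k ih =>
    rw [Finset.sum_range_succ, ← ih, stopped]
    split_ifs <;> simp

lemma lt_stopped_of_le {σ : ℝ} {x : ℕ → ℝ} {j k : ℕ} (hjk : j ≤ k) (h : σ < stopped σ x j) :
    σ < stopped σ x k := by
  induction k, hjk using Nat.le_induction with
  | base => exact h
  | succ k _ ih => rwa [stopped, if_pos ih]

lemma stopped_le {σ : ℝ} (hσ : 0 < σ) (x : ℕ → ℝ) (k : ℕ) :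
    stopped σ x k ≤ 2 * σ + (∑ j ∈ Finset.range k, x j ^ 2) / σ := by
  induction k with
  | zero =>
    simp only [stopped, Finset.range_zero, Finset.sum_empty, zero_div]
    linarith
  | succ k ih =>
    rw [Finset.sum_range_succ, add_div, stopped]
    have h0 : 0 ≤ x k ^ 2 / σ := by positivity
    have h1 : 0 ≤ (∑ j ∈ Finset.range k, x j ^ 2) / σ := by positivity
    split_ifs with h
    · linarith
    · have h2 : x k ≤ σ + x k ^ 2 / σ := by
        rw [← sub_nonneg]
        have : σ + x k ^ 2 / σ - x k = ((x k - σ / 2) ^ 2 + 3 / 4 * σ ^ 2) / σ := by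
          field_simp
          ring
        rw [this]
        positivity
      linarith [not_lt.1 h]

end Stopped

section Game

/-- A round of the fingerprinting game: an angle, and one bit for each of `N` users. -/
abbrev Round (m N : ℕ) : Type := (Bool ⊕ Fin m) × (Fin N → Bool)

variable {m N T : ℕ}

/-- The increments of the score of user `i`, for rounds `ρ` and answers of signs `b`. -/
noncomputable def increment (ρ : Fin T → Round m N) (b : ℕ → Bool) (i : Fin N) (j : ℕ) : ℝ :=
  if h : j < T then sgn (b j) * bitScore (angle (ρ ⟨j, h⟩).1) ((ρ ⟨j, h⟩).2 i) else 0

open Classical in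
/-- The users whose score has exceeded `σ` before round `k`. -/
noncomputable def accused (σ : ℝ) (ρ : Fin T → Round m N) (b : ℕ → Bool) (k : ℕ) :
    Finset (Fin N) :=
  Finset.univ.filter fun i => σ < stopped σ (increment ρ b i) k

lemma mem_accused {σ : ℝ} {ρ : Fin T → Round m N} {b : ℕ → Bool} {k : ℕ} {i : Fin N} :
    i ∈ accused σ ρ b k ↔ σ < stopped σ (increment ρ b i) k := by
  simp [accused]

lemma accused_mono {σ : ℝ} {ρ : Fin T → Round m N} {b : ℕ → Bool} {j k : ℕ} (h : j ≤ k) :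
    accused σ ρ b j ⊆ accused σ ρ b k := fun _ hi =>
  mem_accused.2 (lt_stopped_of_le h (mem_accused.1 hi))

lemma accused_congr {σ : ℝ} {ρ ρ' : Fin T → Round m N} {b b' : ℕ → Bool} {k : ℕ}
    (hρ : ∀ j : Fin T, (j : ℕ) < k → ρ j = ρ' j) (hb : ∀ j < k, j < T → b j = b' j) :
    accused σ ρ b k = accused σ ρ' b' k := by
  ext i
  rw [mem_accused, mem_accused, stopped_congr (y := increment ρ' b' i)]
  intro j hj
  unfold increment
  split_ifs with h
  · rw [hb j hj h, hρ ⟨j, h⟩ hj]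
  · rfl

/-- The sign of each answer depends only on the earlier rounds and on the bits in the current
column of the users in `S` that are not yet accused. -/
def IsAdapted (σ : ℝ) (S : Finset (Fin N)) (b : (Fin T → Round m N) → ℕ → Bool) : Prop :=
  ∀ (k : Fin T) (ρ ρ' : Fin T → Round m N), (∀ j < k, ρ j = ρ' j) →
    (∀ i ∈ S, i ∉ accused σ ρ (b ρ) k → (ρ k).2 i = (ρ' k).2 i) → b ρ k = b ρ' k

variable {σ : ℝ} {S : Finset (Fin N)} {b : (Fin T → Round m N) → ℕ → Bool}

lemma IsAdapted.sign_update_of_lt (hb : IsAdapted σ S b) {j k : Fin T} (hjk : j < k)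
    (ρ : Fin T → Round m N) (a : Round m N) : b (Function.update ρ k a) j = b ρ j :=
  (hb j ρ _ (fun i hi => (Function.update_of_ne (hi.trans hjk).ne _ _).symm)
    (fun i _ _ => by rw [Function.update_of_ne hjk.ne])).symm

lemma IsAdapted.accused_update (hb : IsAdapted σ S b) {j k : Fin T} (hjk : j ≤ k)
    (ρ : Fin T → Round m N) (a : Round m N) :
    accused σ (Function.update ρ k a) (b (Function.update ρ k a)) j = accused σ ρ (b ρ) j := by
  refine accused_congr (fun i hi => ?_) fun i hi hiT => ?_
  · exact Function.update_of_ne (lt_of_lt_of_le (Fin.lt_def.2 hi) hjk).ne _ _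
  · exact hb.sign_update_of_lt (j := ⟨i, hiT⟩) (lt_of_lt_of_le (Fin.lt_def.2 hi) hjk) ρ a

/-- The sign of the answer in round `k`, as a function of the column of that round. -/
def signOfColumn (b : (Fin T → Round m N) → ℕ → Bool) (k : Fin T) (ρ : Fin T → Round m N)
    (c : Fin N → Bool) : Bool :=
  b (Function.update ρ k (.inl true, c)) k

lemma IsAdapted.sign_update_self (hb : IsAdapted σ S b) (k : Fin T) (ρ : Fin T → Round m N)
    (a : Round m N) : b (Function.update ρ k a) k = signOfColumn b k ρ a.2 :=
  hb k _ _ (fun i hi => by simp [hi.ne]) fun i _ _ => by simp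

lemma IsAdapted.signOfColumn_update (hb : IsAdapted σ S b) (k : Fin T) (ρ : Fin T → Round m N)
    (i : Fin N) (hi : i ∉ S \ accused σ ρ (b ρ) k) (c : Fin N → Bool) (x : Bool) :
    signOfColumn b k ρ (Function.update c i x) = signOfColumn b k ρ c := by
  refine hb k _ _ (fun j hj => by simp [hj.ne]) fun j hjS hj => ?_
  rw [hb.accused_update le_rfl] at hj
  have : j ≠ i := fun h => hi (h ▸ Finset.mem_sdiff.2 ⟨hjS, hj⟩)
  simp [this]

/-- The contribution of round `k` to the score of user `i`. -/
noncomputable def contribution (σ : ℝ) (b : (Fin T → Round m N) → ℕ → Bool) (i : Fin N)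
    (k : Fin T) (ρ : Fin T → Round m N) : ℝ :=
  if i ∈ accused σ ρ (b ρ) k then 0 else sgn (b ρ k) * bitScore (angle (ρ k).1) ((ρ k).2 i)

lemma stopped_eq_sum_contribution (σ : ℝ) (b : (Fin T → Round m N) → ℕ → Bool) (i : Fin N)
    (ρ : Fin T → Round m N) :
    stopped σ (increment ρ (b ρ) i) T = ∑ k, contribution σ b i k ρ := by
  rw [stopped_eq_sum, Finset.sum_range]
  refine Finset.sum_congr rfl fun k _ => ?_
  simp only [contribution, mem_accused]
  simp [increment]

lemma sum_increment_sq (b : ℕ → Bool) (i : Fin N) (ρ : Fin T → Round m N) :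
    ∑ j ∈ Finset.range T, increment ρ b i j ^ 2 =
      ∑ k, bitScore (angle (ρ k).1) ((ρ k).2 i) ^ 2 := by
  rw [Finset.sum_range]
  refine Finset.sum_congr rfl fun k _ => ?_
  simp [increment, mul_pow]

/-- The distribution of the sequence of rounds. -/
noncomputable def gameWeight (η : ℝ) (T m N : ℕ) : (Fin T → Round m N) → ℝ :=
  prodWeight fun _ => roundWeight η

variable {η : ℝ}

lemma gameWeight_nonneg (h0 : 0 ≤ η) (h1 : η ≤ 1) (ρ : Fin T → Round m N) :
    0 ≤ gameWeight η T m N ρ :=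
  prodWeight_nonneg (fun _ => roundWeight_nonneg h0 h1) ρ

lemma sum_gameWeight (hm : 1 ≤ m) : ∑ ρ, gameWeight η T m N ρ = 1 :=
  sum_prodWeight fun _ => sum_roundWeight η hm

/-- The score of a user outside `S` is a martingale of small variance. -/
lemma IsAdapted.wexp_stopped_sq_le (hb : IsAdapted σ S b) (h0 : 0 ≤ η) (h1 : η ≤ 1)
    (hm : 1 ≤ m) {i : Fin N} (hi : i ∉ S) :
    wexp (gameWeight η T m N) (fun ρ => stopped σ (increment ρ (b ρ) i) T ^ 2) ≤ T := by
  simp only [stopped_eq_sum_contribution]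
  have h := wexp_sq_sum_le (w := fun _ : Fin T => roundWeight (m := m) (ι := Fin N) η)
    (fun _ => roundWeight_nonneg h0 h1) (fun _ => sum_roundWeight η hm) (contribution σ b i)
    (fun _ => 1)
    (fun j k hjk ρ a => by
      simp only [contribution, hb.accused_update hjk.le, hb.sign_update_of_lt hjk,
        Function.update_of_ne hjk.ne])
    (fun k ρ => by
      simp only [contribution, hb.accused_update le_rfl, hb.sign_update_self,
        Function.update_self]
      split_ifs with hA
      · simp [wexp]
      · exact wexp_round_mul_bitScore_eq_zero η i (F := fun c => sgn (signOfColumn b k ρ c))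
          fun c x => by rw [hb.signOfColumn_update k ρ i fun h => hi (Finset.mem_sdiff.1 h).1])
    (fun k ρ => by
      simp only [contribution, hb.accused_update le_rfl, hb.sign_update_self,
        Function.update_self]
      split_ifs with hA
      · simp [wexp]
      · simp only [mul_pow, sgn_sq, one_mul]
        exact wexp_round_bitScore_sq_le h0 h1 hm i)
  simpa [gameWeight] using h

/-- Few users outside `S` get accused. -/
lemma IsAdapted.wexp_card_accused_le (hb : IsAdapted σ S b) (hσ : 0 < σ) (h0 : 0 ≤ η)
    (h1 : η ≤ 1) (hm : 1 ≤ m) :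
    wexp (gameWeight η T m N) (fun ρ => ((accused σ ρ (b ρ) T \ S).card : ℝ)) ≤
      N * (T / σ ^ 2) := by
  have hle : ∀ ρ, ((accused σ ρ (b ρ) T \ S).card : ℝ) ≤
      ∑ i ∈ Sᶜ, (σ ^ 2)⁻¹ * stopped σ (increment ρ (b ρ) i) T ^ 2 := by
    intro ρ
    have hsub : accused σ ρ (b ρ) T \ S ⊆ Sᶜ := fun i hi => by
      simpa using (Finset.mem_sdiff.1 hi).2
    rw [Finset.card_eq_sum_ones, Nat.cast_sum]
    refine (Finset.sum_le_sum fun i hi => ?_).trans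
      (Finset.sum_le_sum_of_subset_of_nonneg hsub fun i _ _ => by positivity)
    have := mem_accused.1 (Finset.mem_sdiff.1 hi).1
    rw [inv_mul_eq_div, Nat.cast_one, le_div_iff₀ (by positivity), one_mul]
    exact pow_le_pow_left₀ hσ.le this.le 2
  refine (wexp_mono (gameWeight_nonneg h0 h1) hle).trans ?_
  rw [wexp_finset_sum]
  calc _ ≤ ∑ _i ∈ Sᶜ, (T : ℝ) / σ ^ 2 := by
        refine Finset.sum_le_sum fun i hi => ?_
        rw [wexp_const_mul, inv_mul_eq_div]
        exact div_le_div_of_nonneg_right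
          (hb.wexp_stopped_sq_le h0 h1 hm (by simpa using hi)) (by positivity)
    _ ≤ N * (T / σ ^ 2) := by
        rw [Finset.sum_const, nsmul_eq_mul]
        refine mul_le_mul_of_nonneg_right ?_ (by positivity)
        exact_mod_cast (Finset.card_le_univ _).trans_eq (Fintype.card_fin N)

lemma wexp_sum_bitScore_sq_le (h0 : 0 ≤ η) (h1 : η ≤ 1) (hm : 1 ≤ m) (S : Finset (Fin N)) :
    wexp (gameWeight η T m N)
      (fun ρ => ∑ i ∈ S, ∑ k, bitScore (angle (ρ k).1) ((ρ k).2 i) ^ 2) ≤ S.card * T := by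
  simp only [wexp_finset_sum]
  calc _ ≤ ∑ _i ∈ S, ∑ _k : Fin T, (1 : ℝ) := by
        refine Finset.sum_le_sum fun i _ => Finset.sum_le_sum fun k _ => ?_
        rw [gameWeight, wexp_resample k (sum_roundWeight η hm)]
        simp only [Function.update_self]
        exact wexp_le_const (gameWeight_nonneg h0 h1) (sum_gameWeight hm)
          fun _ => wexp_round_bitScore_sq_le h0 h1 hm i
    _ = S.card * T := by simp

/-- The contribution of round `k` to the total score of `S`, plus `lam` if a constant column was
answered with the wrong sign. -/
noncomputable def gain (σ lam : ℝ) (S : Finset (Fin N)) (b : (Fin T → Round m N) → ℕ → Bool)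
    (k : Fin T) (ρ : Fin T → Round m N) : ℝ :=
  sgn (b ρ k) * (∑ i ∈ S \ accused σ ρ (b ρ) k, bitScore (angle (ρ k).1) ((ρ k).2 i)) +
    lam * wrongSign (ρ k) (b ρ k)

/-- The expectation of the gain of round `k` given the earlier rounds. -/
noncomputable def meanGain (η σ lam : ℝ) (S : Finset (Fin N))
    (b : (Fin T → Round m N) → ℕ → Bool) (k : Fin T) (ρ : Fin T → Round m N) : ℝ :=
  wexp (roundWeight η) fun a => gain σ lam S b k (Function.update ρ k a)

lemma sum_gain (σ lam : ℝ) (S : Finset (Fin N)) (b : (Fin T → Round m N) → ℕ → Bool)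
    (ρ : Fin T → Round m N) :
    ∑ k, gain σ lam S b k ρ = ∑ i ∈ S, stopped σ (increment ρ (b ρ) i) T +
      lam * ∑ k, wrongSign (ρ k) (b ρ k) := by
  simp only [gain, Finset.sum_add_distrib, ← Finset.mul_sum, stopped_eq_sum_contribution]
  congr 1
  rw [Finset.sum_comm]
  refine Finset.sum_congr rfl fun k _ => ?_
  rw [Finset.mul_sum, Finset.sdiff_eq_filter, Finset.sum_filter]
  refine Finset.sum_congr rfl fun i _ => ?_
  simp only [contribution, ite_not]

variable {lam : ℝ}

lemma IsAdapted.gain_update_of_lt (hb : IsAdapted σ S b) {j k : Fin T} (hjk : j < k)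
    (ρ : Fin T → Round m N) (a : Round m N) :
    gain σ lam S b j (Function.update ρ k a) = gain σ lam S b j ρ := by
  simp only [gain, hb.accused_update hjk.le, hb.sign_update_of_lt hjk,
    Function.update_of_ne hjk.ne]

lemma IsAdapted.gain_update_self (hb : IsAdapted σ S b) (k : Fin T)
    (ρ : Fin T → Round m N) (a : Round m N) :
    gain σ lam S b k (Function.update ρ k a) =
      sgn (signOfColumn b k ρ a.2) *
        (∑ i ∈ S \ accused σ ρ (b ρ) k, bitScore (angle a.1) (a.2 i)) +
      lam * wrongSign a (signOfColumn b k ρ a.2) := by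
  simp only [gain, hb.accused_update le_rfl, hb.sign_update_self, Function.update_self]

lemma wexp_sub_mean_sq_le {Ω : Type*} [Fintype Ω] {w : Ω → ℝ} (hw : ∑ x, w x = 1) (F : Ω → ℝ) :
    wexp w (fun x => (F x - wexp w F) ^ 2) ≤ wexp w (fun x => F x ^ 2) := by
  have h : ∀ x, (F x - wexp w F) ^ 2 = F x ^ 2 - 2 * wexp w F * F x + wexp w F ^ 2 := fun x => by
    ring
  simp only [h, wexp_add, wexp_sub, wexp_const_mul, wexp_const hw]
  nlinarith [sq_nonneg (wexp w F)]

lemma IsAdapted.wexp_gain_sq_le (hb : IsAdapted σ S b) (h0 : 0 ≤ η) (h1 : η ≤ 1)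
    (hm : 1 ≤ m) (k : Fin T) (ρ : Fin T → Round m N) :
    wexp (roundWeight η) (fun a => gain σ lam S b k (Function.update ρ k a) ^ 2) ≤
      2 * S.card + 2 * lam ^ 2 := by
  simp only [hb.gain_update_self]
  set A := accused σ ρ (b ρ) k
  have hle : ∀ a : Round m N, (sgn (signOfColumn b k ρ a.2) *
        (∑ i ∈ S \ A, bitScore (angle a.1) (a.2 i)) +
      lam * wrongSign a (signOfColumn b k ρ a.2)) ^ 2 ≤
      2 * (∑ i ∈ S \ A, bitScore (angle a.1) (a.2 i)) ^ 2 + 2 * lam ^ 2 := by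
    intro a
    refine (add_sq_le).trans ?_
    rw [mul_pow, sgn_sq, one_mul, mul_pow, mul_add]
    have := pow_le_one₀ (n := 2) (wrongSign_nonneg a (signOfColumn b k ρ a.2))
      (wrongSign_le_one a _)
    have := mul_le_of_le_one_right (sq_nonneg lam) this
    linarith
  refine (wexp_mono (roundWeight_nonneg h0 h1) hle).trans ?_
  rw [wexp_add, wexp_const (sum_roundWeight η hm), wexp_const_mul]
  have hcard : ((S \ A).card : ℝ) ≤ S.card := by
    exact_mod_cast Finset.card_le_card Finset.sdiff_subset
  linarith [wexp_round_sq_sum_bitScore_le h0 h1 hm (S \ A)]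

lemma IsAdapted.wexp_sum_gain_sub_meanGain_sq_le (hb : IsAdapted σ S b) (h0 : 0 ≤ η)
    (h1 : η ≤ 1) (hm : 1 ≤ m) :
    wexp (gameWeight η T m N)
      (fun ρ => (∑ k, (gain σ lam S b k ρ - meanGain η σ lam S b k ρ)) ^ 2) ≤
      T * (2 * S.card + 2 * lam ^ 2) := by
  have hself : ∀ k ρ a, meanGain η σ lam S b k (Function.update ρ k a) =
      meanGain η σ lam S b k ρ := fun k ρ a => by
    simp only [meanGain, Function.update_idem]
  have h := wexp_sq_sum_le (w := fun _ : Fin T => roundWeight (m := m) (ι := Fin N) η)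
    (fun _ => roundWeight_nonneg h0 h1) (fun _ => sum_roundWeight η hm)
    (fun k ρ => gain σ lam S b k ρ - meanGain η σ lam S b k ρ)
    (fun _ => 2 * S.card + 2 * lam ^ 2)
    (fun j k hjk ρ a => by
      simp only [hb.gain_update_of_lt hjk, meanGain, Function.update_comm hjk.ne'])
    (fun k ρ => by
      simp only [hself]
      rw [wexp_sub, wexp_const (sum_roundWeight η hm)]
      exact sub_self _)
    (fun k ρ => by
      simp only [hself]
      exact (wexp_sub_mean_sq_le (sum_roundWeight η hm) _).trans
        (hb.wexp_gain_sq_le h0 h1 hm k ρ))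
  rwa [Finset.sum_const, Finset.card_univ, Fintype.card_fin, nsmul_eq_mul] at h

/-- The numerical incompatibility of the bounds on the total score `s` of the colluders, the
number of errors `e`, and the total conditional expectation `t` of the gains. -/
lemma score_bounds_contradictory {n L η β lam s e t : ℝ} (hn : 1 ≤ n) (hη : 0 < η) (hβ : 0 ≤ β)
    (hβη : β = 1 / 2 - η) (hL' : 1100 * n ≤ L * η ^ 2) (hL : 4400 ≤ L) (hlam0 : 0 ≤ lam)
    (hlam2 : lam ≤ 2) (hlamη : lam * (1 - η) / 2 = 2 * η / Real.pi)
    (hdev : -(L ^ 2 * η ^ 2 / 8) < s + lam * e - t)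
    (hscore : s ≤ 400 * n * L + n * L / 20)
    (hsum : L ^ 2 * (2 * η / Real.pi - η * (η / 10)) ≤ t)
    (herr : e ≤ β * (L ^ 2 + n + 11)) : False := by
  have hL0 : 0 < L := by linarith
  have hn0 : 0 < n := by linarith
  have hlamerr := mul_le_mul_of_nonneg_left herr hlam0
  have hlamβ : lam * β ≤ 2 * η / Real.pi - 2 / Real.pi * η ^ 2 := by
    have h3 : 2 * η / Real.pi - 2 / Real.pi * η ^ 2 = lam * ((1 - η) ^ 2 / 2) := by
      have : lam * ((1 - η) ^ 2 / 2) = (lam * (1 - η) / 2) * (1 - η) := by ring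
      rw [this, hlamη]
      ring
    rw [h3]
    refine mul_le_mul_of_nonneg_left ?_ hlam0
    nlinarith [sq_nonneg η]
  have hinvπ : 3 / 5 ≤ 2 / Real.pi := by
    rw [le_div_iff₀ Real.pi_pos]
    linarith [Real.pi_lt_d2]
  have hlamβ1 : lam * β ≤ 1 := by
    have := mul_le_mul hlam2 (show β ≤ 1 / 2 by linarith) hβ (by norm_num)
    linarith
  have hnL : 4400 * n ≤ n * L := by
    rw [mul_comm n]
    exact mul_le_mul_of_nonneg_right hL hn0.le
  have hkey : L ^ 2 * (lam * β) ≤ L ^ 2 * (2 * η / Real.pi) - L ^ 2 * (3 / 5 * η ^ 2) := by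
    rw [← mul_sub]
    refine mul_le_mul_of_nonneg_left (hlamβ.trans ?_) (by positivity)
    have := mul_le_mul_of_nonneg_right hinvπ (sq_nonneg η)
    linarith
  have hkey2 : lam * β * (n + 11) ≤ n * L / 20 :=
    (mul_le_of_le_one_left (by positivity) hlamβ1).trans (by linarith)
  have e1 : lam * (β * (L ^ 2 + n + 11)) = L ^ 2 * (lam * β) + lam * β * (n + 11) := by ring
  have e2 : L ^ 2 * (2 * η / Real.pi - η * (η / 10)) =
      L ^ 2 * (2 * η / Real.pi) - L ^ 2 * η ^ 2 / 10 := by ring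
  have e3 : L ^ 2 * (3 / 5 * η ^ 2) = 3 / 5 * (L ^ 2 * η ^ 2) := by ring
  have hbig : 1100 * (n * L) ≤ L ^ 2 * η ^ 2 :=
    calc 1100 * (n * L) = 1100 * n * L := by ring
      _ ≤ L * η ^ 2 * L := mul_le_mul_of_nonneg_right hL' hL0.le
      _ = L ^ 2 * η ^ 2 := by ring
  have hnL0 : 0 < n * L := mul_pos hn0 hL0
  rw [e1] at hlamerr
  rw [e2] at hsum
  rw [e3] at hkey
  linarith

/-- With the stated parameters, an oracle holding the columns of at most `n` out of `2000 n` users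
will probably make many errors of sign on constant columns, while few users get accused. -/
theorem IsAdapted.wprob_few_errors_le {n L : ℕ} (hn : 1 ≤ n) {β : ℝ} (hη0 : 0 < η)
    (hβ : 0 ≤ β) (hβη : β = 1 / 2 - η)
    (hL : 1100 * n / η ^ 2 ≤ (L : ℝ)) (hm : 1 ≤ m)
    {S : Finset (Fin (2000 * n))} (hS : S.card ≤ n)
    (hgrid : ∀ F : (Fin (2000 * n) → Bool) → ℝ, (∀ c, |F c| ≤ 1) →
      |(∑ k : Fin m, wexp (colWeight (Fin (2000 * n)) (gridAngle k))
          (fun c => F c * ∑ i, bitScore (gridAngle k) (c i))) / m -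
        (F (fun _ => true) - F (fun _ => false)) / Real.pi| ≤ η / 10)
    {b : (Fin (L ^ 2) → Round m (2000 * n)) → ℕ → Bool} (hb : IsAdapted (200 * L) S b) :
    wprob (gameWeight η (L ^ 2) m (2000 * n))
      {ρ | (accused (200 * L) ρ (b ρ) (L ^ 2)).card ≤ 2 * n →
        ∑ k, wrongSign (ρ k) (b ρ k) ≤ β * (L ^ 2 + n + 11)} ≤ 2 / 5 := by
  have hη1 : η ≤ 1 / 2 := by linarith
  have h1 : η ≤ 1 := by linarith
  have hn1 : (1 : ℝ) ≤ n := by exact_mod_cast hn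
  have hπ0 := Real.pi_pos
  have hπ3 := Real.pi_gt_three
  have hπ4 := Real.pi_lt_d2
  have hL' : 1100 * n ≤ L * η ^ 2 := by rwa [div_le_iff₀ (by positivity)] at hL
  have hη2 : η ^ 2 ≤ 1 / 4 := by nlinarith
  have hL1 : (4400 : ℝ) ≤ L := by
    have : (0 : ℝ) ≤ L := Nat.cast_nonneg L
    nlinarith
  have hL0 : (0 : ℝ) < L := by linarith
  have hSn : (S.card : ℝ) ≤ n := by exact_mod_cast hS
  set σ : ℝ := 200 * L with hσ
  have hσ0 : 0 < σ := by positivity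
  set lam : ℝ := 4 * η / (Real.pi * (1 - η)) with hlam
  have hlamη : lam * (1 - η) / 2 = 2 * η / Real.pi := by
    have : 1 - η ≠ 0 := by linarith
    rw [hlam]
    field_simp
    ring
  have hlam0 : 0 ≤ lam := div_nonneg (by linarith) (mul_nonneg hπ0.le (by linarith))
  have hlam2 : lam ≤ 2 := by
    rw [hlam, div_le_iff₀ (mul_pos hπ0 (by linarith))]
    nlinarith
  have hmean : ∀ k ρ, 2 * η / Real.pi - η * (η / 10) ≤ meanGain η σ lam S b k ρ := by
    intro k ρ
    have := le_wexp_correlation_add_wrongSign hη0.le hlamη hm hgrid (signOfColumn b k ρ)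
      (S \ accused σ ρ (b ρ) k) (hb.signOfColumn_update k ρ)
    simpa only [meanGain, hb.gain_update_self] using this
  set w := gameWeight η (L ^ 2) m (2000 * n) with hw
  have hw0 : ∀ ρ, 0 ≤ w ρ := gameWeight_nonneg hη0.le h1
  set E₁ : Set (Fin (L ^ 2) → Round m (2000 * n)) := {ρ | (L ^ 2 * η ^ 2 / 8) ^ 2 ≤
    (∑ k, (gain σ lam S b k ρ - meanGain η σ lam S b k ρ)) ^ 2} with hE₁
  set E₂ : Set (Fin (L ^ 2) → Round m (2000 * n)) := {ρ | 10 * n * (L : ℝ) ^ 2 ≤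
    ∑ i ∈ S, ∑ k, bitScore (angle (ρ k).1) ((ρ k).2 i) ^ 2} with hE₂
  set E₃ : Set (Fin (L ^ 2) → Round m (2000 * n)) := {ρ | (n : ℝ) ≤
    ((accused σ ρ (b ρ) (L ^ 2) \ S).card : ℝ)} with hE₃
  have hp₁ : wprob w E₁ ≤ 1 / 10 := by
    have h := (mul_wprob_le_wexp hw0 (fun ρ => sq_nonneg _) ((L ^ 2 * η ^ 2 / 8) ^ 2)).trans
      (hb.wexp_sum_gain_sub_meanGain_sq_le (lam := lam) hη0.le h1 hm)
    have hV : (2 * S.card + 2 * lam ^ 2 : ℝ) ≤ 10 * n := by nlinarith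
    have h2 : ((L ^ 2 : ℕ) : ℝ) * (2 * S.card + 2 * lam ^ 2) ≤
        (L ^ 2 * η ^ 2 / 8) ^ 2 * (1 / 10) := by
      push_cast
      have h3 : (10 * n : ℝ) ≤ (L * η ^ 2) ^ 2 / 640 := by nlinarith
      calc (L : ℝ) ^ 2 * (2 * S.card + 2 * lam ^ 2) ≤ (L : ℝ) ^ 2 * ((L * η ^ 2) ^ 2 / 640) :=
            mul_le_mul_of_nonneg_left (hV.trans h3) (by positivity)
        _ = _ := by ring
    exact le_of_mul_le_mul_left (h.trans h2) (by positivity)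
  have hp₂ : wprob w E₂ ≤ 1 / 10 := by
    have h := (mul_wprob_le_wexp hw0 (fun ρ => Finset.sum_nonneg fun i _ =>
      Finset.sum_nonneg fun k _ => sq_nonneg _) (10 * n * (L : ℝ) ^ 2)).trans
      (wexp_sum_bitScore_sq_le hη0.le h1 hm S)
    have h2 : (S.card : ℝ) * (L ^ 2 : ℕ) ≤ 10 * n * (L : ℝ) ^ 2 * (1 / 10) := by
      push_cast
      nlinarith [mul_le_mul_of_nonneg_right hSn (sq_nonneg (L : ℝ))]
    exact le_of_mul_le_mul_left (h.trans h2) (by positivity)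
  have hp₃ : wprob w E₃ ≤ 1 / 10 := by
    have h := (mul_wprob_le_wexp hw0 (fun ρ => Nat.cast_nonneg _) (n : ℝ)).trans
      (hb.wexp_card_accused_le hσ0 hη0.le h1 hm)
    have h2 : ((2000 * n : ℕ) : ℝ) * ((L ^ 2 : ℕ) / σ ^ 2) ≤ n * (1 / 10) := by
      have : (((L ^ 2 : ℕ) : ℝ) / σ ^ 2) = 1 / 40000 := by
        rw [hσ]
        push_cast
        field_simp
        norm_num
      rw [this]
      push_cast
      linarith
    exact le_of_mul_le_mul_left (h.trans h2) (by positivity)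
  refine (wprob_mono hw0 (E' := E₁ ∪ E₂ ∪ E₃) fun ρ hρ => ?_).trans ?_
  · by_contra hnot
    simp only [Set.mem_union, not_or, hE₁, hE₂, hE₃, Set.mem_ofPred_eq, not_le] at hnot
    obtain ⟨⟨hd, hs⟩, hc⟩ := hnot
    have hcard : (accused σ ρ (b ρ) (L ^ 2)).card ≤ 2 * n := by
      have h := Finset.card_le_card
        (show accused σ ρ (b ρ) (L ^ 2) ⊆ (accused σ ρ (b ρ) (L ^ 2) \ S) ∪ S by simp)
      have h' := h.trans (Finset.card_union_le _ _)
      have hc' : (accused σ ρ (b ρ) (L ^ 2) \ S).card < n := by exact_mod_cast hc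
      omega
    have herr : ∑ k, wrongSign (ρ k) (b ρ k) ≤ β * (L ^ 2 + n + 11) := hρ hcard
    have hscore : ∑ i ∈ S, stopped σ (increment ρ (b ρ) i) (L ^ 2) ≤
        400 * n * L + n * L / 20 := by
      calc _ ≤ ∑ i ∈ S, (2 * σ +
            (∑ k, bitScore (angle (ρ k).1) ((ρ k).2 i) ^ 2) / σ) :=
            Finset.sum_le_sum fun i _ => by
              rw [← sum_increment_sq (b ρ) i ρ]
              exact stopped_le hσ0 _ _
        _ = S.card * (2 * σ) +
            (∑ i ∈ S, ∑ k, bitScore (angle (ρ k).1) ((ρ k).2 i) ^ 2) / σ := by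
            rw [Finset.sum_add_distrib, Finset.sum_const, nsmul_eq_mul, Finset.sum_div]
        _ ≤ n * (2 * σ) + 10 * n * (L : ℝ) ^ 2 / σ := by gcongr
        _ = _ := by
            rw [hσ]
            field_simp
            ring
    have hdev := (abs_lt_of_sq_lt_sq hd (by positivity))
    have hdev' := (abs_lt.1 hdev).1
    rw [Finset.sum_sub_distrib, sum_gain] at hdev'
    have hsum : ((L : ℝ) ^ 2) * (2 * η / Real.pi - η * (η / 10)) ≤
        ∑ k, meanGain η σ lam S b k ρ := by
      have := Finset.sum_le_sum fun k (_ : k ∈ Finset.univ) => hmean k ρ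
      rwa [Finset.sum_const, Finset.card_univ, Fintype.card_fin, nsmul_eq_mul, Nat.cast_pow]
        at this
    exact score_bounds_contradictory hn1 hη0 hβ hβη hL' hL1 hlam0 hlam2 hlamη hdev' hscore hsum herr
  · refine (wprob_union_le hw0 _ _).trans ?_
    linarith [wprob_union_le hw0 E₁ E₂]

end Game

universe u

section Transcript

variable {n d : ℕ}

/-- The answer in round `j` of the interaction. -/
def playAnswer (O : Oracle.{u} n d) (A : Adversary d) (s : A.Coins) (ω : O.Coins)
    (x : Fin n → Cube d) (j : ℕ) : Value :=
  O.answer j ω x (transcript O A s ω x j) (A.query j s (transcript O A s ω x j))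

lemma transcript_apply (O : Oracle.{u} n d) (A : Adversary d) (s : A.Coins) (ω : O.Coins)
    (x : Fin n → Cube d) {k : ℕ} (j : Fin k) :
    transcript O A s ω x k j =
      (A.query j s (transcript O A s ω x j), playAnswer O A s ω x j) := by
  induction k with
  | zero => exact j.elim0
  | succ k ih =>
    rw [transcript]
    induction j using Fin.lastCases with
    | last => rw [Fin.snoc_last]; rfl
    | cast j => rw [Fin.snoc_castSucc, ih]; rfl

/-- The sign of a value. -/
noncomputable def signBit (a : Value) : Bool := decide (0 ≤ (a : ℝ))

/-- The signs of the answers in a history. -/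
noncomputable def signs {k : ℕ} (h : History d k) (j : Fin k) : Bool := signBit (h j).2

/-- A finite sequence of bits, continued by `false`. -/
def extendBits {k : ℕ} (b : Fin k → Bool) (j : ℕ) : Bool := if h : j < k then b ⟨j, h⟩ else false

lemma extendBits_signs_transcript (O : Oracle.{u} n d) (A : Adversary d) (s : A.Coins)
    (ω : O.Coins) (x : Fin n → Cube d) {j k : ℕ} (h : j < k) :
    extendBits (signs (transcript O A s ω x k)) j = signBit (playAnswer O A s ω x j) := by
  simp [extendBits, h, signs, transcript_apply]

lemma measurable_signs {k : ℕ} : Measurable (signs : History d k → Fin k → Bool) := by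
  refine measurable_pi_iff.2 fun j => ?_
  have h : Measurable fun h : History d k => (((h j).2 : Value) : ℝ) :=
    measurable_subtype_coe.comp (measurable_snd.comp (measurable_pi_apply j))
  exact measurable_to_bool (by
    have : (fun c : History d k => signs c j) ⁻¹' {true} =
        (fun h : History d k => (((h j).2 : Value) : ℝ)) ⁻¹' Set.Ici 0 := by
      ext c
      simp [signs, signBit]
    rw [this]
    exact h measurableSet_Ici)

lemma measurable_of_signs {k : ℕ} {α : Type*} [MeasurableSpace α] [DiscreteMeasurableSpace α]
    [Countable α] (g : α → (Fin k → Bool) → Query d) :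
    Measurable fun p : α × History d k => g p.1 (signs p.2) := by
  have h : Measurable fun p : α × (Fin k → Bool) => g p.1 p.2 :=
    measurable_from_prod_countable_right fun _ => Measurable.of_discrete
  exact h.comp (measurable_fst.prodMk (measurable_signs.comp measurable_snd))

end Transcript

section Attack

variable {d m N T : ℕ}

/-- The value `±1` of a bit. -/
def bitValue (b : Bool) : Value := ⟨sgn b, by cases b <;> simp⟩

/-- The coins of the attack: a pad for each round and user, and the rounds. -/
abbrev AttackCoins (T m N : ℕ) : Type := (Fin T → Fin N → Bool) × (Fin T → Round m N)

/-- The distribution of the coins of the attack. -/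
noncomputable def coinWeight (η : ℝ) (s : AttackCoins T m N) : ℝ :=
  (Fintype.card (Fin T → Fin N → Bool) : ℝ)⁻¹ * gameWeight η T m N s.2

lemma coinWeight_nonneg {η : ℝ} (h0 : 0 ≤ η) (h1 : η ≤ 1) (s : AttackCoins T m N) :
    0 ≤ coinWeight η s :=
  mul_nonneg (by positivity) (gameWeight_nonneg h0 h1 _)

lemma sum_coinWeight (η : ℝ) (hm : 1 ≤ m) : ∑ s : AttackCoins T m N, coinWeight η s = 1 := by
  simp only [coinWeight, Fintype.sum_prod_type, ← Finset.mul_sum, sum_gameWeight hm]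
  simp

/-- The point of the cube held by user `i`: the name `i` together with the column entries of the
user, masked by the pad. -/
def userPoint (enc : Fin N × (Fin T → Bool) → Cube d) (s : AttackCoins T m N) (i : Fin N) :
    Cube d :=
  enc (i, fun j => xor (s.1 j i) ((s.2 j).2 i))

/-- The query of round `k`: it unmasks the column entry of each user not yet accused. -/
noncomputable def attackQuery (dec : Cube d → Fin N × (Fin T → Bool)) (σ : ℝ) (k : ℕ)
    (s : AttackCoins T m N) (b : ℕ → Bool) : Query d := fun y =>
  if hk : k < T then
    if (dec y).1 ∈ accused σ s.2 b k then ⟨0, by simp⟩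
    else bitValue (xor (s.1 ⟨k, hk⟩ (dec y).1) ((dec y).2 ⟨k, hk⟩))
  else ⟨0, by simp⟩

/-- The uniform distribution on the users. -/
noncomputable def userLaw (N : ℕ) [NeZero N] : Measure (Fin N) :=
  (PMF.uniformOfFintype (Fin N)).toMeasure

instance (N : ℕ) [NeZero N] : IsProbabilityMeasure (userLaw N) := by
  unfold userLaw
  infer_instance

/-- The fingerprinting attack. -/
noncomputable abbrev attack [NeZero N] {η : ℝ} (h0 : 0 ≤ η) (h1 : η ≤ 1) (hm : 1 ≤ m) (σ : ℝ)
    (enc : Fin N × (Fin T → Bool) → Cube d) (dec : Cube d → Fin N × (Fin T → Bool)) :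
    Adversary d where
  Coins := AttackCoins T m N
  measurableSpace := ⊤
  law := ∑ s : AttackCoins T m N, ENNReal.ofReal (coinWeight η s) • @Measure.dirac _ ⊤ s
  isProbabilityMeasure := ⟨by
    simp only [Measure.coe_finsetSum, Measure.coe_smul, Finset.sum_apply, Pi.smul_apply,
      measure_univ, smul_eq_mul, mul_one]
    rw [← ENNReal.ofReal_sum_of_nonneg fun s _ => coinWeight_nonneg h0 h1 s, sum_coinWeight η hm,
      ENNReal.ofReal_one]⟩
  dist := @Kernel.mk _ _ ⊤ _ (fun s => (userLaw N).map (userPoint enc s)) measurable_from_top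
  isMarkovKernel := @IsMarkovKernel.mk _ _ ⊤ _ _ fun s =>
    Measure.isProbabilityMeasure_map (Measurable.of_discrete).aemeasurable
  query k s h := attackQuery dec σ k s (extendBits (signs h))
  measurable_query k := by
    exact @measurable_of_signs _ _ _ ⊤ (@DiscreteMeasurableSpace.mk _ ⊤ fun _ => trivial)
      inferInstance
      fun (s : AttackCoins T m N) b => attackQuery dec σ k s (extendBits b)

end Attack

section Mean

variable {d m N T : ℕ} {enc : Fin N × (Fin T → Bool) → Cube d}
  {dec : Cube d → Fin N × (Fin T → Bool)}

lemma mean_map_userLaw [NeZero N] (q : Query d) (g : Fin N → Cube d) :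
    q.mean ((userLaw N).map g) = (∑ i, (q (g i) : ℝ)) / N := by
  rw [Query.mean, integral_map Measurable.of_discrete.aemeasurable
    Measurable.of_discrete.aestronglyMeasurable, userLaw, PMF.integral_eq_sum, Finset.sum_div]
  refine Finset.sum_congr rfl fun i _ => ?_
  simp [div_eq_inv_mul]

lemma attackQuery_userPoint (hdec : Function.LeftInverse dec enc) (σ : ℝ) (k : Fin T)
    (s : AttackCoins T m N) (b : ℕ → Bool) (i : Fin N) :
    (attackQuery dec σ k s b (userPoint enc s i) : ℝ) =
      if i ∈ accused σ s.2 b k then 0 else sgn ((s.2 k).2 i) := by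
  simp only [attackQuery, userPoint, hdec _, k.2, dif_pos]
  split_ifs <;> simp [bitValue]

/-- When few users are accused, an answer of the wrong sign to a constant column is far from the
truth. -/
lemma not_abs_sub_mean_le {n : ℕ} [NeZero (2000 * n)] (hn : 1 ≤ n)
    {enc : Fin (2000 * n) × (Fin T → Bool) → Cube d}
    {dec : Cube d → Fin (2000 * n) × (Fin T → Bool)}
    (hdec : Function.LeftInverse dec enc) {σ : ℝ} {k : Fin T}
    {s : AttackCoins T m (2000 * n)} {b : ℕ → Bool} (hA : (accused σ s.2 b k).card ≤ 2 * n)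
    {b₀ : Bool} (hcol : (s.2 k).2 = fun _ => b₀) {a : Value} (ha : signBit a ≠ b₀) :
    ¬ |(a : ℝ) - (attackQuery dec σ k s b).mean
      ((userLaw (2000 * n)).map (userPoint enc s))| ≤ 0.99 := by
  classical
  have hn0 : (1 : ℝ) ≤ n := by exact_mod_cast hn
  have hsum : ∑ i : Fin (2000 * n), (if i ∈ accused σ s.2 b k then 0 else sgn b₀) =
      ((2000 * n : ℕ) - (accused σ s.2 b k).card) * sgn b₀ := by
    rw [← Finset.sum_filter_not_add_sum_filter _ (· ∈ accused σ s.2 b k),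
      Finset.sum_congr rfl (g := fun _ => sgn b₀)
        (fun i hi => if_neg (Finset.mem_filter.1 hi).2),
      Finset.sum_congr rfl (g := fun _ => (0 : ℝ))
        (fun i hi => if_pos (Finset.mem_filter.1 hi).2)]
    have hc : (Finset.univ.filter (· ∉ accused σ s.2 b k)) = (accused σ s.2 b k)ᶜ := by
      ext i
      simp
    rw [hc, Finset.sum_const, Finset.card_compl, nsmul_eq_mul,
      Nat.cast_sub (Finset.card_le_univ _)]
    simp
  have hmean : (attackQuery dec σ k s b).mean ((userLaw (2000 * n)).map (userPoint enc s)) =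
      (1 - (accused σ s.2 b k).card / (2000 * n)) * sgn b₀ := by
    rw [mean_map_userLaw]
    simp only [attackQuery_userPoint hdec, hcol, hsum]
    push_cast
    field_simp
  have hfrac : ((accused σ s.2 b k).card : ℝ) / (2000 * n) ≤ 1 / 1000 := by
    rw [div_le_iff₀ (by positivity)]
    have : ((accused σ s.2 b k).card : ℝ) ≤ 2 * n := by exact_mod_cast hA
    linarith
  rw [hmean, not_le, lt_abs]
  cases b₀
  · have : 0 ≤ (a : ℝ) := by simpa [signBit] using ha
    left
    rw [sgn_false]
    norm_num
    linarith
  · have : (a : ℝ) < 0 := by simpa [signBit] using ha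
    right
    rw [sgn_true]
    norm_num
    linarith

end Mean

section Accused

variable {d m T n : ℕ} {η : ℝ}

lemma accused_extendBits {N : ℕ} [NeZero N] {enc : Fin N × (Fin T → Bool) → Cube d}
    {dec : Cube d → Fin N × (Fin T → Bool)} {h0 : 0 ≤ η} {h1 : η ≤ 1} {hm : 1 ≤ m} {σ : ℝ}
    (O : Oracle.{u} n d) (s : AttackCoins T m N) (ω : O.Coins) (x : Fin n → Cube d) (k : ℕ) :
    accused σ s.2
        (extendBits (signs (transcript O (attack h0 h1 hm σ enc dec) s ω x k))) k =
      accused σ s.2 (fun j => signBit (playAnswer O (attack h0 h1 hm σ enc dec) s ω x j)) k :=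
  accused_congr (fun _ _ => rfl) fun _ hj _ => extendBits_signs_transcript _ _ _ _ _ hj

end Accused

section Accuracy

variable {d m T n : ℕ} [NeZero (2000 * n)] {enc : Fin (2000 * n) × (Fin T → Bool) → Cube d}
  {dec : Cube d → Fin (2000 * n) × (Fin T → Bool)} {η : ℝ}

/-- A mostly accurate transcript has few errors of sign, if few users are accused. -/
lemma sum_wrongSign_le_of_mostlyAccurate (hn : 1 ≤ n) (hdec : Function.LeftInverse dec enc)
    {h0 : 0 ≤ η} {h1 : η ≤ 1} {hm : 1 ≤ m} {σ β : ℝ} {ℓ : ℕ} (hℓ : T ≤ ℓ)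
    (O : Oracle.{u} n d) (s : AttackCoins T m (2000 * n)) (ω : O.Coins) (x : Fin n → Cube d)
    (hacc : MostlyAccurate 0.99 β ((userLaw (2000 * n)).map (userPoint enc s))
      (transcript O (attack h0 h1 hm σ enc dec) s ω x ℓ))
    (hA : (accused σ s.2
      (fun j => signBit (playAnswer O (attack h0 h1 hm σ enc dec) s ω x j)) T).card ≤ 2 * n) :
    ∑ k : Fin T, wrongSign (s.2 k)
      (signBit (playAnswer O (attack h0 h1 hm σ enc dec) s ω x k)) ≤ β * ℓ := by
  classical
  set A := attack h0 h1 hm σ enc dec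
  set P : Fin ℓ → Prop := fun j => |((transcript O A s ω x ℓ j).2 : ℝ) -
    (transcript O A s ω x ℓ j).1.mean ((userLaw (2000 * n)).map (userPoint enc s))| ≤ 0.99
    with hP
  have hle : ∀ k : Fin T, wrongSign (s.2 k) (signBit (playAnswer O A s ω x k)) ≤
      if P (Fin.castLE hℓ k) then 0 else 1 := by
    intro k
    unfold wrongSign
    split_ifs with hw hPk
    · exfalso
      obtain ⟨b₀, -, hcol, hsign⟩ := hw
      refine not_abs_sub_mean_le hn hdec (σ := σ)
        (b := extendBits (signs (transcript O A s ω x k))) ?_ hcol hsign ?_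
      · rw [accused_extendBits]
        exact (Finset.card_le_card (accused_mono k.2.le)).trans hA
      · simp only [hP, transcript_apply] at hPk
        exact hPk
    · exact le_rfl
    · exact le_rfl
    · exact zero_le_one
  refine (Finset.sum_le_sum fun k _ => hle k).trans ?_
  have hmap : ∑ k : Fin T, (if P (Fin.castLE hℓ k) then (0 : ℝ) else 1) ≤
      ∑ j : Fin ℓ, if P j then (0 : ℝ) else 1 := by
    refine (Finset.sum_map Finset.univ (Fin.castLEEmb hℓ)
      fun j => if P j then (0 : ℝ) else 1).symm.trans_le ?_
    exact Finset.sum_le_sum_of_subset_of_nonneg (Finset.subset_univ _)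
      fun j _ _ => by split_ifs <;> simp
  refine hmap.trans ?_
  have hcount : ∑ j : Fin ℓ, (if P j then (0 : ℝ) else 1) =
      ℓ - ((Finset.univ.filter P).card : ℝ) := by
    have h1 : ∀ j, (if P j then (0 : ℝ) else 1) = 1 - if P j then 1 else 0 := fun j => by
      split_ifs <;> simp
    simp only [h1, Finset.sum_sub_distrib, Finset.sum_boole]
    simp
  have hacc' : (1 - β) * (ℓ : ℝ) ≤ ((Finset.univ.filter P).card : ℝ) := by
    unfold MostlyAccurate at hacc
    convert hacc
  rw [hcount]
  linarith

end Accuracy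

section Masking

variable {d m N T n : ℕ} {enc : Fin N × (Fin T → Bool) → Cube d}
  {dec : Cube d → Fin N × (Fin T → Bool)} {η σ : ℝ} {h0 : 0 ≤ η} {h1 : η ≤ 1} {hm : 1 ≤ m}

/-- Exchange the pads of the users in `S` with their masked column entries. -/
def maskPads (S : Finset (Fin N)) (s : AttackCoins T m N) : AttackCoins T m N :=
  (fun j i => xor (s.1 j i) (decide (i ∈ S) && (s.2 j).2 i), s.2)

lemma maskPads_involutive (S : Finset (Fin N)) :
    Function.Involutive (maskPads (T := T) (m := m) S) := fun s => by
  simp [maskPads]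

lemma userPoint_maskPads {S : Finset (Fin N)} {i : Fin N} (hi : i ∈ S)
    (r : Fin T → Fin N → Bool) (ρ : Fin T → Round m N) :
    userPoint enc (maskPads S (r, ρ)) i = enc (i, fun j => r j i) := by
  simp [userPoint, maskPads, hi]

lemma attackQuery_maskPads_congr {S : Finset (Fin N)} (r : Fin T → Fin N → Bool)
    {ρ ρ' : Fin T → Round m N} {b : ℕ → Bool} {k : ℕ}
    (hρ : ∀ j : Fin T, (j : ℕ) < k → ρ j = ρ' j)
    (hk : ∀ hk : k < T, ∀ i ∈ S, i ∉ accused σ ρ b k → (ρ ⟨k, hk⟩).2 i = (ρ' ⟨k, hk⟩).2 i) :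
    attackQuery dec σ k (maskPads S (r, ρ)) b = attackQuery dec σ k (maskPads S (r, ρ')) b := by
  have hA : accused σ ρ b k = accused σ ρ' b k := accused_congr hρ fun _ _ _ => rfl
  funext y
  simp only [attackQuery, maskPads, ← hA]
  by_cases h1 : k < T
  · by_cases h2 : (dec y).1 ∈ accused σ ρ b k
    · simp only [h1, h2, dif_pos, if_pos]
    · by_cases hS : (dec y).1 ∈ S
      · simp only [h1, h2, hS, dif_pos, if_neg, hk h1 _ hS h2, not_false_eq_true]
      · simp only [h1, h2, hS, dif_pos, if_neg, decide_false, Bool.false_and, not_false_eq_true]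
  · simp only [h1, dif_neg, not_false_eq_true]

variable [NeZero N]

lemma transcript_maskPads_congr (O : Oracle.{u} n d) (ω : O.Coins) (x : Fin n → Cube d)
    {S : Finset (Fin N)} (r : Fin T → Fin N → Bool) {ρ ρ' : Fin T → Round m N} {k : ℕ}
    (hρ : ∀ j : Fin T, (j : ℕ) < k → ρ j = ρ' j) :
    transcript O (attack h0 h1 hm σ enc dec) (maskPads S (r, ρ)) ω x k =
      transcript O (attack h0 h1 hm σ enc dec) (maskPads S (r, ρ')) ω x k := by
  induction k with
  | zero => rfl
  | succ k ih =>
    have ih' := ih fun j hj => hρ j (by omega)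
    have hq : ∀ b, attackQuery dec σ k (maskPads S (r, ρ)) b =
        attackQuery dec σ k (maskPads S (r, ρ')) b := fun b =>
      attackQuery_maskPads_congr r (fun j hj => hρ j (by omega))
        fun hk i _ _ => by rw [hρ ⟨k, hk⟩ (Nat.lt_succ_self k)]
    simp only [transcript]
    rw [ih', hq]

/-- For fixed coins of the oracle, samples and masked pads, the signs of the answers depend on the
rounds as in the fingerprinting game. -/
lemma isAdapted_maskPads (O : Oracle.{u} n d) (ω : O.Coins) (x : Fin n → Cube d)
    (S : Finset (Fin N)) (r : Fin T → Fin N → Bool) :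
    IsAdapted σ S fun ρ j => signBit
      (playAnswer O (attack h0 h1 hm σ enc dec) (maskPads (m := m) S (r, ρ)) ω x j) := by
  intro k ρ ρ' hρ hk
  have ht := transcript_maskPads_congr (h0 := h0) (h1 := h1) (hm := hm) (σ := σ) (enc := enc)
    (dec := dec) O ω x (S := S) r (k := k) (fun j hj => hρ j hj)
  have hq : attackQuery dec σ k (maskPads S (r, ρ)) (extendBits (signs
        (transcript O (attack h0 h1 hm σ enc dec) (maskPads S (r, ρ)) ω x k))) =
      attackQuery dec σ k (maskPads S (r, ρ')) (extendBits (signs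
        (transcript O (attack h0 h1 hm σ enc dec) (maskPads S (r, ρ)) ω x k))) := by
    refine attackQuery_maskPads_congr r (fun j hj => hρ j hj) fun _ i hi hiA => hk i hi ?_
    have := accused_extendBits (h0 := h0) (h1 := h1) (hm := hm) (σ := σ) (enc := enc)
      (dec := dec) O (maskPads S (r, ρ)) ω x k
    exact fun hi' => hiA (this.symm.subset hi')
  simp only [playAnswer]
  rw [← ht, hq]

end Masking

section Main

variable {d m T n : ℕ} {η : ℝ}

lemma wprob_coinWeight_le_of_maskPads {N : ℕ} (S : Finset (Fin N))
    (E : Set (AttackCoins T m N)) {a : ℝ}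
    (h : ∀ r, wprob (gameWeight η T m N) {ρ | maskPads S (r, ρ) ∈ E} ≤ a) :
    wprob (coinWeight η) E ≤ a := by
  classical
  have hperm : wprob (coinWeight η) E = ∑ s : AttackCoins T m N,
      E.indicator (coinWeight η) (maskPads S s) :=
    (Equiv.sum_comp (maskPads_involutive S).toPerm (E.indicator (coinWeight η))).symm
  rw [hperm, Fintype.sum_prod_type]
  have hrow : ∀ r : Fin T → Fin N → Bool,
      ∑ ρ : Fin T → Round m N, E.indicator (coinWeight η) (maskPads S (r, ρ)) =
      (Fintype.card (Fin T → Fin N → Bool) : ℝ)⁻¹ *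
        wprob (gameWeight η T m N) {ρ | maskPads S (r, ρ) ∈ E} := by
    intro r
    rw [wprob, Finset.mul_sum]
    refine Finset.sum_congr rfl fun ρ _ => ?_
    by_cases hE : maskPads S (r, ρ) ∈ E
    · rw [Set.indicator_of_mem hE, Set.indicator_of_mem (by exact hE)]
      rfl
    · rw [Set.indicator_of_notMem hE, Set.indicator_of_notMem (by exact hE), mul_zero]
  simp only [hrow]
  calc _ ≤ ∑ _r : Fin T → Fin N → Bool, (Fintype.card (Fin T → Fin N → Bool) : ℝ)⁻¹ * a :=
        Finset.sum_le_sum fun r _ => mul_le_mul_of_nonneg_left (h r) (by positivity)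
    _ = a := by
        have : (Fintype.card (Fin T → Fin N → Bool) : ℝ) ≠ 0 :=
          Nat.cast_ne_zero.2 Fintype.card_ne_zero
        rw [Finset.sum_const, Finset.card_univ, nsmul_eq_mul, mul_inv_cancel_left₀ this]

lemma sum_mul_lintegral_le {α σ : Type*} [MeasurableSpace α] (μ : Measure α) (t : Finset σ)
    (c : σ → ℝ≥0∞) (f : σ → α → ℝ≥0∞) :
    ∑ s ∈ t, c s * ∫⁻ x, f s x ∂μ ≤ ∫⁻ x, ∑ s ∈ t, c s * f s x ∂μ := by
  classical
  induction t using Finset.induction_on with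
  | empty => simp
  | insert s t hs ih =>
    simp only [Finset.sum_insert hs]
    exact (add_le_add (lintegral_const_mul_le _ _) ih).trans (le_lintegral_add _ _)

/-- It suffices to bound the probability of success for each choice of the coins of the oracle and
of the names of the sampled users. -/
lemma accuracyProb_attack_le {N : ℕ} [NeZero N] {enc : Fin N × (Fin T → Bool) → Cube d}
    {dec : Cube d → Fin N × (Fin T → Bool)} (h0 : 0 ≤ η) (h1 : η ≤ 1) (hm : 1 ≤ m) {σ α β a : ℝ}
    {ℓ : ℕ} (O : Oracle.{u} n d)
    (h : ∀ (ω : O.Coins) (I : Fin n → Fin N), wprob (coinWeight η) {s : AttackCoins T m N |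
      MostlyAccurate α β ((userLaw N).map (userPoint enc s))
        (transcript O (attack h0 h1 hm σ enc dec) s ω (fun t => userPoint enc s (I t)) ℓ)} ≤ a) :
    accuracyProb O (attack h0 h1 hm σ enc dec) ℓ α β ≤ ENNReal.ofReal a := by
  classical
  set E : O.Coins → (Fin n → Fin N) → Set (AttackCoins T m N) := fun ω I => {s |
      MostlyAccurate α β ((userLaw N).map (userPoint enc s))
        (transcript O (attack h0 h1 hm σ enc dec) s ω (fun t => userPoint enc s (I t)) ℓ)} with hE
  have hinner : ∀ (s : AttackCoins T m N) (ω : O.Coins),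
      (Measure.pi fun _ : Fin n => (userLaw N).map (userPoint enc s))
        {x | MostlyAccurate α β ((userLaw N).map (userPoint enc s))
          (transcript O (attack h0 h1 hm σ enc dec) s ω x ℓ)} =
      ∫⁻ I, (E ω I).indicator 1 s ∂(Measure.pi fun _ : Fin n => userLaw N) := by
    intro s ω
    rw [← Measure.pi_map_pi (μ := fun _ : Fin n => userLaw N)
      (f := fun _ => userPoint enc s) fun _ => Measurable.of_discrete.aemeasurable,
      Measure.map_apply Measurable.of_discrete (MeasurableSet.of_discrete),
      ← lintegral_indicator_one MeasurableSet.of_discrete]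
    rfl
  have hprob : accuracyProb O (attack h0 h1 hm σ enc dec) ℓ α β =
      ∑ s : AttackCoins T m N, ENNReal.ofReal (coinWeight η s) *
        ∫⁻ ω, ∫⁻ I, (E ω I).indicator 1 s ∂(Measure.pi fun _ : Fin n => userLaw N) ∂O.law := by
    have hlaw : ∀ F : AttackCoins T m N → ℝ≥0∞,
        @lintegral _ ⊤ (∑ s : AttackCoins T m N,
          ENNReal.ofReal (coinWeight η s) • @Measure.dirac _ ⊤ s) F =
        ∑ s, ENNReal.ofReal (coinWeight η s) * F s := by
      intro F
      rw [@lintegral_finsetSum_measure]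
      refine Finset.sum_congr rfl fun s _ => ?_
      rw [@lintegral_smul_measure, @lintegral_dirac' _ ⊤ _ _ measurable_from_top, smul_eq_mul]
    simp only [← hinner]
    exact hlaw _
  rw [hprob]
  refine (sum_mul_lintegral_le _ _ _ _).trans ?_
  calc _ ≤ ∫⁻ _ω : O.Coins, ENNReal.ofReal a ∂O.law := by
        refine lintegral_mono fun ω => (sum_mul_lintegral_le _ _ _ _).trans ?_
        calc _ ≤ ∫⁻ _I, ENNReal.ofReal a ∂(Measure.pi fun _ : Fin n => userLaw N) := by
              refine lintegral_mono fun I => ?_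
              refine le_trans (le_of_eq ?_) (ENNReal.ofReal_le_ofReal (h ω I))
              rw [wprob, ENNReal.ofReal_sum_of_nonneg fun s _ =>
                Set.indicator_nonneg (fun s _ => coinWeight_nonneg h0 h1 s) s]
              refine Finset.sum_congr rfl fun s _ => ?_
              by_cases hs : s ∈ E ω I
              · rw [Set.indicator_of_mem hs, Set.indicator_of_mem (by exact hs), Pi.one_apply,
                  mul_one]
              · rw [Set.indicator_of_notMem hs, Set.indicator_of_notMem (by exact hs), mul_zero,
                  ENNReal.ofReal_zero]
          _ = ENNReal.ofReal a := by simp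
    _ = ENNReal.ofReal a := by simp

/-- The fingerprinting attack defeats every oracle. -/
theorem accuracyProb_attack_le_two_fifths [NeZero (2000 * n)] (hn : 1 ≤ n) {β : ℝ} (hβ : 0 ≤ β)
    (hη : 0 < η) (hβη : β = 1 / 2 - η) {L : ℕ} (hL : 1100 * n / η ^ 2 ≤ (L : ℝ)) (hm : 1 ≤ m)
    (hgrid : ∀ F : (Fin (2000 * n) → Bool) → ℝ, (∀ c, |F c| ≤ 1) →
      |(∑ k : Fin m, wexp (colWeight (Fin (2000 * n)) (gridAngle k))
          (fun c => F c * ∑ i, bitScore (gridAngle k) (c i))) / m -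
        (F (fun _ => true) - F (fun _ => false)) / Real.pi| ≤ η / 10)
    {enc : Fin (2000 * n) × (Fin (L ^ 2) → Bool) → Cube d}
    {dec : Cube d → Fin (2000 * n) × (Fin (L ^ 2) → Bool)}
    (hdec : Function.LeftInverse dec enc) (h1 : η ≤ 1) (O : Oracle.{u} n d) :
    accuracyProb O (attack hη.le h1 hm (200 * L) enc dec) (L ^ 2 + n + 11) 0.99 β ≤
      ENNReal.ofReal (2 / 5) := by
  classical
  refine accuracyProb_attack_le hη.le h1 hm O fun ω I => ?_
  set S : Finset (Fin (2000 * n)) := Finset.univ.image I with hS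
  have hcard : S.card ≤ n := Finset.card_image_le.trans (by simp)
  refine wprob_coinWeight_le_of_maskPads S _ fun r => ?_
  have hb := isAdapted_maskPads (h0 := hη.le) (h1 := h1) (hm := hm) (σ := 200 * L) (enc := enc)
    (dec := dec) O ω (fun t => enc (I t, fun j => r j (I t))) S r
  refine (wprob_mono (gameWeight_nonneg hη.le h1) fun ρ hρ => ?_).trans
    (hb.wprob_few_errors_le hn hη hβ hβη hL hm hcard hgrid)
  intro hA
  have hx : (fun t => userPoint enc (maskPads S (r, ρ)) (I t)) =
      fun t => enc (I t, fun j => r j (I t)) :=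
    funext fun t => userPoint_maskPads (Finset.mem_image_of_mem I (Finset.mem_univ t)) r ρ
  have hacc : MostlyAccurate 0.99 β
      ((userLaw (2000 * n)).map (userPoint enc (maskPads S (r, ρ))))
      (transcript O (attack hη.le h1 hm (200 * L) enc dec) (maskPads S (r, ρ)) ω
        (fun t => enc (I t, fun j => r j (I t))) (L ^ 2 + n + 11)) := by
    rw [← hx]
    exact hρ
  have := sum_wrongSign_le_of_mostlyAccurate hn hdec (by omega) O _ ω _ hacc hA
  push_cast at this
  exact this

end Main

end AdaptiveSQ

theorem mainTheorem3 :
    ∃ (C : ℝ) (ℓ : ℕ → ℝ → ℕ), ∀ β : ℝ, 0 ≤ β → β < 1 / 2 → ∀ n : ℕ, 1 ≤ n →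
      (ℓ n β : ℝ) ≤ C * ((n : ℝ) ^ 2 / (1 / 2 - β) ^ 4) ∧
      ∀ d : ℕ, ℓ n β ≤ d →
        ¬ ∃ O : AdaptiveSQ.Oracle n d, O.IsAccurate 0.99 β (1 / 2) (ℓ n β) := by
  refine ⟨1101 ^ 2 + 12, fun n β => ⌈1100 * n / (1 / 2 - β) ^ 2⌉₊ ^ 2 + n + 11, ?_⟩
  intro β hβ hβ' n hn
  set η : ℝ := 1 / 2 - β with hη
  have hη0 : 0 < η := by linarith
  have hη1 : η ≤ 1 := by linarith
  have hn1 : (1 : ℝ) ≤ n := by exact_mod_cast hn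
  set L : ℕ := ⌈1100 * n / η ^ 2⌉₊ with hL
  have hηsq : η ^ 2 ≤ 1 := pow_le_one₀ hη0.le hη1
  have hone : 1 ≤ n / η ^ 2 := by
    rw [le_div_iff₀ (by positivity)]
    linarith
  refine ⟨?_, ?_⟩
  · have hLle : (L : ℝ) ≤ 1101 * (n / η ^ 2) := by
      have := (Nat.ceil_lt_add_one (show 0 ≤ 1100 * n / η ^ 2 by positivity)).le
      rw [mul_div_assoc] at this
      rw [hL, mul_div_assoc]
      linarith
    have h4 : (n : ℝ) ^ 2 / η ^ 4 = (n / η ^ 2) ^ 2 := by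
      rw [div_pow]
      ring
    have hnle : (n : ℝ) ≤ n / η ^ 2 := by
      rw [le_div_iff₀ (by positivity)]
      exact mul_le_of_le_one_right (by linarith) hηsq
    have hL2 := pow_le_pow_left₀ (Nat.cast_nonneg L) hLle 2
    have hsq : (n : ℝ) / η ^ 2 ≤ (n / η ^ 2) ^ 2 :=
      le_self_pow₀ hone two_ne_zero
    rw [h4]
    push_cast
    rw [mul_pow] at hL2
    linarith
  · rintro d hd ⟨O, hO⟩
    have : NeZero (2000 * n) := ⟨by omega⟩
    obtain ⟨m, hm, hgrid⟩ := AdaptiveSQ.exists_grid (Fin (2000 * n))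
      (show 0 < η / 10 by positivity)
    have hcard : Fintype.card (Fin (2000 * n) × (Fin (L ^ 2) → Bool)) ≤
        Fintype.card (AdaptiveSQ.Cube d) := by
      simp only [Fintype.card_prod, Fintype.card_fin, Fintype.card_fun, Fintype.card_bool]
      calc 2000 * n * 2 ^ L ^ 2 ≤ 2 ^ (n + 11) * 2 ^ L ^ 2 := by
            refine Nat.mul_le_mul_right _ ?_
            have := (Nat.lt_two_pow_self (n := n)).le
            rw [pow_add]
            omega
        _ = 2 ^ (L ^ 2 + n + 11) := by ring
        _ ≤ 2 ^ d := Nat.pow_le_pow_right (by norm_num) hd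
    obtain ⟨e⟩ := Function.Embedding.nonempty_of_card_le hcard
    have hle := AdaptiveSQ.accuracyProb_attack_le_two_fifths hn hβ hη0 (by rw [hη]; ring)
      (Nat.le_ceil _) hm hgrid (Function.leftInverse_invFun e.injective) hη1 O
    have := (hO _).trans hle
    rw [ENNReal.ofReal_le_ofReal_iff (by norm_num)] at this
    norm_num at this
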